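/- **Conventions.** In forcing, the stronger condition is the larger one. $\mathbf H$ is a function on $\omega$ whose values are countable sets with at least two elements; $u\vartriangleleft v$ means that $u$ is a proper initial segment of $v$; $\forall^\infty$ means "for all but finitely many". *Functions.* $h:\omega\times\omega\to\omega$ is *regressive* if for all $m$: $1\le h(m,k)<k$ for $k>1$, and $h(m,k)\le h(m,\ell)$ for $k<\ell$. A family $\mathcal F\subseteq\omega^\omega$ is *$h$-closed* if $(\forall f\in\mathcal F)(\exists f^*\in\mathcal F)(\forall^\infty n)(f^*(n)\le h(n,f(n)))$, and *$\ge^*$-directed* if $(\forall f_0,f_1\in\mathcal F)(\exists f^*\in\mathcal F)(\forall^\infty n)(f^*(n)\le\min\{f_0(n),f_1(n)\})$. *Creating pairs.* A creature $t$ for $\mathbf H$ consists of a norm $\mathrm{nor}[t]\in[0,\infty)$, integers $m^t_{\rm dn}<m^t_{\rm up}$, a nonempty set $\mathbf{val}[t]$ of pairs $\langle u,v\rangle\in\prod_{i<m^t_{\rm dn}}\mathbf H(i)\times\prod_{i<m^t_{\rm up}}\mathbf H(i)$ with $u\vartriangleleft v$, and a label. A creating pair $(K,\Sigma)$ is a set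 $K$ of creatures with a composition operation $\Sigma:[K]^{<\omega}\to\mathcal P(K)$ in the sense of Rosłanowski and Shelah: $\Sigma(\emptyset)=\emptyset$; $t\in\Sigma(t)$; if $\Sigma(\mathcal S)\ne\emptyset\neq\mathcal S$ then $\mathcal S=\{t_0,\dots,t_k\}$ with $m^{t_i}_{\rm up}=m^{t_{i+1}}_{\rm dn}$ for $i<k$, and every $s\in\Sigma(\mathcal S)$ satisfies $m^s_{\rm dn}=m^{t_0}_{\rm dn}$, $m^s_{\rm up}=m^{t_k}_{\rm up}$, $\mathrm{dom}(\mathbf{val}[s])=\mathrm{dom}(\mathbf{val}[t_0])$ and $\langle v{\restriction}m^{t_i}_{\rm dn},v{\restriction}m^{t_i}_{\rm up}\rangle\in\mathbf{val}[t_i]$ for $\langle u,v\rangle\in\mathbf{val}[s]$, $i\le k$; and $\Sigma$ is transitive (if $s_i\in\Sigma(\mathcal S_i)$ for $i\le n$ and $m^{s_i}_{\rm up}=m^{s_{i+1}}_{\rm dn}$ for $i<n$, then $\Sigma(s_0,\dots,s_n)\subseteq\Sigma(\bigcup_i\mathcal S_i)$). The pair is *local* if $m^t_{\rm up}=m^t_{\rm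 dn}+1$ for all $t\in K$. It is *forgetful* if $\langle u,v\rangle\in\mathbf{val}[t]$ and $w\in\prod_{i<m^t_{\rm dn}}\mathbf H(i)$ imply $\langle w,w^\frown v{\restriction}[m^t_{\rm dn},m^t_{\rm up})\rangle\in\mathbf{val}[t]$; for a local forgetful pair, $\mathbf{val}[t]$ is determined by $\mathrm{pos}(t)=\{v(m^t_{\rm dn}):\langle u,v\rangle\in\mathbf{val}[t]\}\subseteq\mathbf H(m^t_{\rm dn})$. A local forgetful pair is *complete* if for all $i$ and nonempty $A\subseteq\mathbf H(i)$ there is a unique $t=t^i_A\in K$ with $m^t_{\rm dn}=i$, $\mathrm{pos}(t)=A$, and if $\emptyset\neq A\subseteq B\subseteq\mathbf H(i)$ then $t^i_A\in\Sigma(t^i_B)$ and $\mathrm{nor}[t^i_A]\le\mathrm{nor}[t^i_B]$. It is *$h$-linked* if, whenever $k>1$ is an integer, $t_0,t_1\in K$ have norms $\ge k$, $m^{t_0}_{\rm dn}=m^{t_1}_{\rm dn}$ and $m^{t_0}_{\rm up}=m^{t_1}_{\rm up}$, there is $s\in\Sigma(t_0)\cap\Sigma(t_1)$ with $\mathrm{nor}[s]\ge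 h(m^{t_0}_{\rm dn},k)$. *The forcing notion.* Let $\mathrm{pos}(w,t_0,\dots,t_n)$ be the set of $v\in\prod_{j<m^{t_n}_{\rm up}}\mathbf H(j)$ with $w\vartriangleleft v$ and $\langle v{\restriction}m^{t_i}_{\rm dn},v{\restriction}m^{t_i}_{\rm up}\rangle\in\mathbf{val}[t_i]$ for $i\le n$. Let $\mathbb Q^*_\emptyset(K,\Sigma)$ be the set of all $(w,t_0,t_1,\dots)$ with $t_i\in K$, $m^{t_i}_{\rm up}=m^{t_{i+1}}_{\rm dn}$, $w\in\mathrm{dom}(\mathbf{val}[t_0])$ and $\mathrm{pos}(w,t_0,\dots,t_i)\subseteq\mathrm{dom}(\mathbf{val}[t_{i+1}])$; a sequence $\langle t_0,t_1,\dots\rangle$ for which there is such a $w$ is a *pure candidate*. $\mathbb Q^*_{\mathcal F}(K,\Sigma)$ is the set of those $(w,t_0,t_1,\dots)\in\mathbb Q^*_\emptyset(K,\Sigma)$ for which $(\exists f\in\mathcal F)(\forall^\infty i)(\mathrm{nor}[t_i]\ge f(m^{t_i}_{\rm dn}))$. There $p\le q$ iff $q$ is obtained from $p$ by finitely many steps within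 $\mathbb Q^*_\emptyset(K,\Sigma)$, each replacing $(w,t_0,t_1,\dots)$ by either $(w^*,t_n,t_{n+1},\dots)$ with $w^*\in\mathrm{pos}(w,t_0,\dots,t_{n-1})$ ($w^*=w$ if $n=0$), or $(w,t_0^*,t_1^*,\dots)$ with $t^*_i\in\Sigma(t_{n_i},\dots,t_{n_{i+1}-1})$ for some $0=n_0<n_1<\cdots$. A condition is coded by the point $(w,\mathbf{val}[t_0],\mathbf{val}[t_1],\dots)$ of the natural Polish space (a countable discrete space times a countable power of the power set of a countable set); Borel functions into $\mathbb Q^*_{\mathcal F}(K,\Sigma)$ and definability refer to this coding. A forcing notion is *Souslin* if its coding is injective and the set of (codes of) conditions, the order and the incompatibility relation are $\Sigma^1_1$. *Sourness systems.* A sourness system for $(K,\Sigma,\mathcal F)$ is a pair $(\bar g,\bar\ell)$ such that $\bar\ell=\langle\ell_k:k<\omega\rangle$ is a strictly increasing sequence of natural numbers; $\bar g=\langle g_\rho:\rho\in2^{<\omega}\rangle$, where $g_\rho\in\prod_{i<\ell_k}\mathcal P(\mathbf H(i))$ for $\rho\in2^k$, and $g_{\rho'}$ extends $g_\rho$ if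 $\rho'$ extends $\rho$; for $\ell_k\le n<\ell_{k+1}$ the sets $g_\rho(n)$, $\rho\in2^{k+1}$, are nonempty and $g_\rho(n)\cap g_{\rho'}(n)=\emptyset$ for $\rho\ne\rho'$, and $\mathbf H(n)\setminus\bigcup_{\rho\in2^{k+1}}g_\rho(n)\ne\emptyset$; and whenever $f\in\mathcal F$, $\langle t_0,t_1,\dots\rangle$ is a pure candidate, $m^{t_0}_{\rm dn}=\ell_{k_0}$ and $\mathrm{nor}[t_n]\ge f(n+\ell_{k_0})$ for all $n$, then (i) for some $N$, for every $k\ge k_0$, at most $N$ sequences $\rho\in2^{k+1}$ satisfy $|\{n\in[\ell_k,\ell_{k+1}):g_\rho(n)\cap\mathrm{pos}(t_{n-\ell_{k_0}})\ne\emptyset\}|<2^{k+1}$, and (ii) for some $k_1\ge k_0$, for all $k\ge k_1$ and $n\in[\ell_k,\ell_{k+1})$, $\mathrm{pos}(t_{n-\ell_{k_0}})\setminus\bigcup_{\rho\in2^{k+1}}g_\rho(n)\ne\emptyset$. *Sourness over Cohen.* A standard $\mathbb Q$-name $\dot\tau$ for an element of $2^\omega$ is a system $\langle q^n_{\eta,k}:n<\omega,\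 \eta\in2^n,\ k<N_\eta\rangle$ of conditions, $N_\eta\le\omega$, such that for every $n$ the system $\langle q^n_{\eta,k}:\eta\in 2^n,\ k<N_\eta\rangle$ is a maximal antichain, and for $\nu\vartriangleleft\eta$ each $q^{{\rm lh}(\eta)}_{\eta,k}$ is above some $q^{{\rm lh}(\nu)}_{\nu,m}$; $q^n_{\eta,k}$ forces $\eta\vartriangleleft\dot\tau$. $\mathbb Q$ is *very explicitly sour over Cohen* if there are standard $\mathbb Q$-names $\dot\tau_0,\dot\tau_1$ for elements of $2^\omega$ such that * for $j<2$, there is an isomorphism from ${\rm RO}(2^{<\omega})$ onto the complete subalgebra of ${\rm RO}(\mathbb Q)$ generated by the Boolean values $[\![\eta\vartriangleleft\dot\tau_j]\!]$, $\eta\in2^{<\omega}$, which sends $[\![\eta\vartriangleleft\dot W]\!]$ to $[\![\eta\vartriangleleft\dot\tau_j]\!]$ for each $\eta$, where $\dot W$ is the canonical name for the Cohen real; and * there are Borel functions $g_0,g_1:2^\omega\times\omega\to\mathbb Q$ such that $\{g_j(x,n):n<\omega\}$ is predense in $\mathbb Q$ for all $x\in2^\omega$, $j<2$, and whenever $x_0\ne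 x_1$ in $2^\omega$, $x_0{\restriction}m=x_1{\restriction}m$ and $k_0,k_1<m$, there are $n<\omega$ and disjoint $A_0,A_1\subseteq2^n$ such that for $j<2$ every $q\in\mathbb Q$ with $q\ge g_j(x_0,k_j)$ and $q\ge g_j(x_1,k_j)$ forces $\dot\tau_j{\restriction}n\in A_j$. **Theorem.** Suppose that $h:\omega\times\omega\to\omega$ is regressive and that $\mathcal F\subseteq(\omega\setminus2)^\omega$ is a countable, $h$-closed and $\ge^*$-directed family. Let $(K,\Sigma)$ be a local, $h$-linked and complete creating pair for $\mathbf H$ such that * (a) for some $f^*\in\mathcal F$ we have $\mathrm{nor}[t^n_{\mathbf H(n)}]\ge f^*(n)$ for all $n<\omega$; * (b) there is a sourness system $(\bar g,\bar\ell)$ for $(K,\Sigma,\mathcal F)$, and * (c) (for this system) if $A\subseteq\mathbf H(n)$, $\ell_k\le n<\ell_{k+1}$, $\rho\in2^{k+1}$ and $A\setminus g_\rho(n)\ne\emptyset$, then $\mathrm{nor}[t^n_{A\setminus g_\rho(n)}]\ge h(n,\lfloor\mathrm{nor}[t^n_A]\rfloor)$. Then the forcing notion $\mathbb Q^*_{\mathcal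 F}(K,\Sigma)$ satisfies the ccc and is very explicitly sour over Cohen. If, moreover, the sets $\{A\subseteq\mathbf H(n): A\neq\emptyset,\ \mathrm{nor}[t^n_A]\ge j\}$ ($n,j<\omega$) are $\Sigma^1_1$ (which is automatic when the sets $\mathbf H(n)$ are finite), then $\mathbb Q^*_{\mathcal F}(K,\Sigma)$ is also Souslin. -/

import Mathlib

open Set Filter Topology
open scoped NNReal

noncomputable section

/-! ### Finite and infinite sequences -/

/-- The tree `⋃ₙ ∏_{i<n} H(i)` of finite sequences. -/
structure FinSeq (H : ℕ → Type*) where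
  /-- The length of the sequence. -/
  len : ℕ
  /-- The entries of the sequence. -/
  entry : ∀ i : Fin len, H i

namespace FinSeq

variable {H : ℕ → Type*}

/-- `u ≤ v` means that `u` is an initial segment of `v`. -/
instance : Preorder (FinSeq H) where
  le u v := ∃ h : u.len ≤ v.len, ∀ (i : ℕ) (hi : i < u.len),
    u.entry ⟨i, hi⟩ = v.entry ⟨i, hi.trans_le h⟩
  le_refl _ := ⟨le_rfl, fun _ _ => rfl⟩
  le_trans _ _ _ h₁ h₂ := ⟨h₁.1.trans h₂.1,
    fun i hi => (h₁.2 i hi).trans (h₂.2 i (hi.trans_le h₁.1))⟩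

/-- The tree of finite sequences is a discrete space. -/
instance : TopologicalSpace (FinSeq H) := ⊥

/-- The restriction `v ↾ m` (it is `v` itself if `m` is at least the length of `v`). -/
def res (v : FinSeq H) (m : ℕ) : FinSeq H :=
  ⟨min m v.len, fun i => v.entry ⟨i.1, i.2.trans_le (min_le_right _ _)⟩⟩

/-- The concatenation `w ⌢ v ↾ [lh w, lh v)`. -/
def splice (w v : FinSeq H) : FinSeq H :=
  ⟨v.len, fun i => if h : i.1 < w.len then w.entry ⟨i.1, h⟩ else v.entry i⟩

end FinSeq

/-- The space `∏ᵢ H(i)`. -/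
def Branch (H : ℕ → Type*) : Type _ := ∀ i : ℕ, H i

/-- The product of the discrete topologies. -/
instance (H : ℕ → Type*) : TopologicalSpace (Branch H) :=
  @Pi.topologicalSpace ℕ H (fun _ => ⊥)

/-! ### Forcing notions; a stronger condition is the larger one -/

section Forcing

variable {P : Type*} [Preorder P]

/-- Two conditions are compatible if they have a common upper bound. -/
def Compat (p q : P) : Prop := ∃ r, p ≤ r ∧ q ≤ r

/-- A set is predense if every condition is compatible with one of its members. -/
def IsPredense (S : Set P) : Prop := ∀ p : P, ∃ s ∈ S, Compat p s

variable (P) in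
/-- The countable chain condition. -/
def IsCCC : Prop :=
  ∀ A : Set P, (∀ p ∈ A, ∀ q ∈ A, p ≠ q → ¬ Compat p q) → A.Countable

variable (P) in
/-- `RO(P)`: the regular open subsets of `P` in the topology whose open sets are the upward
closed sets (so the closure of `U` is `{q | ∃ r ≥ q, r ∈ U}`), ordered by inclusion. -/
abbrev RegOpen : Type _ := {U : Set P // ∀ p, p ∈ U ↔ ∀ q, p ≤ q → ∃ r, q ≤ r ∧ r ∈ U}

namespace RegOpen

/-- The supremum in `RO(P)` of (the canonical images of) the conditions in `S`, that is, the set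
of all conditions which force that the generic filter meets `S`. -/
def hull (S : Set P) : RegOpen P :=
  ⟨{p | ∀ q, p ≤ q → ∃ r, q ≤ r ∧ ∃ s ∈ S, s ≤ r}, fun p => by
    constructor
    · intro hp q hq
      exact ⟨q, le_rfl, fun q' hq' => hp q' (hq.trans hq')⟩
    · intro h q hq
      obtain ⟨r, hr, hr'⟩ := h q hq
      obtain ⟨r', h₁, h₂⟩ := hr' r le_rfl
      exact ⟨r', hr.trans h₁, h₂⟩⟩

/-- The complement in the Boolean algebra `RO(P)`. -/
def compl (U : RegOpen P) : RegOpen P :=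
  ⟨{p | ∀ q, p ≤ q → q ∉ U.1}, fun p => by
    constructor
    · intro hp q hq
      exact ⟨q, le_rfl, fun q' hq' => hp q' (hq.trans hq')⟩
    · intro h q hq hqU
      obtain ⟨r, hr, hr'⟩ := h q hq
      refine hr' r le_rfl ((U.2 r).2 fun s hs => ?_)
      exact (U.2 q).1 hqU s (hr.trans hs)⟩

/-- The supremum of a family in the complete Boolean algebra `RO(P)`. -/
def sup (S : Set (RegOpen P)) : RegOpen P := hull (⋃ U ∈ S, U.1)

/-- `B` is a complete subalgebra of `RO(P)`. -/
def IsCompleteSubalgebra (B : Set (RegOpen P)) : Prop :=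
  (∀ U ∈ B, compl U ∈ B) ∧ ∀ S ⊆ B, sup S ∈ B

/-- The complete subalgebra of `RO(P)` generated by `G`. -/
def generated (G : Set (RegOpen P)) : Set (RegOpen P) :=
  ⋂₀ {B | IsCompleteSubalgebra B ∧ G ⊆ B}

end RegOpen

variable (P) in
/-- A standard `P`-name for an element of `∏ᵢ H(i)`: a system `⟨q η k : k < N η⟩`, where
`N η ≤ ω`, which is a maximal antichain on each level and such that longer sequences come with
stronger conditions. The condition `q η k` forces that the name extends `η`; the values `q η k`
for `k ≥ N η` have no meaning. -/
structure StandardName (H : ℕ → Type*) where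
  N : FinSeq H → ℕ∞
  q : FinSeq H → ℕ → P
  antichain : ∀ (η ν : FinSeq H) (k m : ℕ), η.len = ν.len → (k : ℕ∞) < N η → (m : ℕ∞) < N ν →
    (η, k) ≠ (ν, m) → ¬ Compat (q η k) (q ν m)
  maximal : ∀ (n : ℕ) (p : P), ∃ (η : FinSeq H) (k : ℕ),
    η.len = n ∧ (k : ℕ∞) < N η ∧ Compat p (q η k)
  coherent : ∀ (ν η : FinSeq H) (k : ℕ), ν < η → (k : ℕ∞) < N η →
    ∃ m : ℕ, (m : ℕ∞) < N ν ∧ q ν m ≤ q η k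

namespace StandardName

variable {H : ℕ → Type*}

/-- The Boolean value in `RO(P)` of the statement that `η` is an initial segment of `τ`. -/
def value (τ : StandardName P H) (η : FinSeq H) : RegOpen P :=
  RegOpen.hull {p | ∃ k : ℕ, (k : ℕ∞) < τ.N η ∧ p = τ.q η k}

/-- `p` forces that `τ ↾ n ∈ A`. -/
def Forces (τ : StandardName P H) (p : P) (n : ℕ) (A : Set (∀ i : Fin n, H i)) : Prop :=
  p ∈ (RegOpen.hull {r | ∃ a ∈ A, ∃ k : ℕ, (k : ℕ∞) < τ.N ⟨n, a⟩ ∧ r = τ.q ⟨n, a⟩ k}).1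

end StandardName

/-- There is an isomorphism from `RO(P)` onto the complete subalgebra of `RO(Q)` generated by the
Boolean values of the `Q`-name `τ`, and it maps the `P`-name `W` onto `τ`. -/
def IsCopyOf {Q : Type*} [Preorder Q] {H : ℕ → Type*}
    (W : StandardName P H) (τ : StandardName Q H) : Prop :=
  ∃ f : RegOpen P ≃o ↥(RegOpen.generated (range τ.value)),
    ∀ η : FinSeq H, (f (W.value η) : RegOpen Q) = τ.value η

/-- A forcing notion whose conditions are coded by points of a Polish space `Z` is Souslin if the
set of conditions, the order and the incompatibility relation are `Σ¹₁`. -/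
def IsSouslin {Z : Type*} [TopologicalSpace Z] (code : P → Z) : Prop :=
  Function.Injective code ∧
  MeasureTheory.AnalyticSet (range code) ∧
  MeasureTheory.AnalyticSet {z : Z × Z | ∃ p q : P, p ≤ q ∧ z = (code p, code q)} ∧
  MeasureTheory.AnalyticSet {z : Z × Z | ∃ p q : P, ¬ Compat p q ∧ z = (code p, code q)}

end Forcing

/-- `(Q₀, τ₀)` is very explicitly sour to `(Q₁, τ₁)`. Borel functions into a forcing notion are
understood through the coding of its conditions by points of a Polish space. -/
def VeryExplicitlySourTo {H : ℕ → Type*} {Q₀ Q₁ Z₀ Z₁ : Type*} [Preorder Q₀] [Preorder Q₁]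
    [TopologicalSpace Z₀] [TopologicalSpace Z₁] (code₀ : Q₀ → Z₀) (code₁ : Q₁ → Z₁)
    (τ₀ : StandardName Q₀ H) (τ₁ : StandardName Q₁ H) : Prop :=
  ∃ (g₀ : Branch H × ℕ → Q₀) (g₁ : Branch H × ℕ → Q₁),
    @Measurable _ _ (borel (Branch H × ℕ)) (borel Z₀) (fun y => code₀ (g₀ y)) ∧
    @Measurable _ _ (borel (Branch H × ℕ)) (borel Z₁) (fun y => code₁ (g₁ y)) ∧
    (∀ x : Branch H, IsPredense (range fun n : ℕ => g₀ (x, n))) ∧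
    (∀ x : Branch H, IsPredense (range fun n : ℕ => g₁ (x, n))) ∧
    ∀ (x₀ x₁ : Branch H) (m k₀ k₁ : ℕ), x₀ ≠ x₁ → (∀ i < m, x₀ i = x₁ i) → k₀ < m → k₁ < m →
      ∃ (n : ℕ) (A₀ A₁ : Set (∀ i : Fin n, H i)), Disjoint A₀ A₁ ∧
        (∀ q : Q₀, g₀ (x₀, k₀) ≤ q → g₀ (x₁, k₀) ≤ q → τ₀.Forces q n A₀) ∧
        (∀ q : Q₁, g₁ (x₀, k₁) ≤ q → g₁ (x₁, k₁) ≤ q → τ₁.Forces q n A₁)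

/-- `Q` is very explicitly sour (to itself) over `(P, W)`. -/
def VeryExplicitlySourOver {H : ℕ → Type*} {P Q Z : Type*} [Preorder P] [Preorder Q]
    [TopologicalSpace Z] (W : StandardName P H) (code : Q → Z) : Prop :=
  ∃ τ₀ τ₁ : StandardName Q H, IsCopyOf W τ₀ ∧ IsCopyOf W τ₁ ∧
    VeryExplicitlySourTo code code τ₀ τ₁

/-- The Cohen forcing notion `2^{<ω}`, ordered by end-extension. -/
abbrev CohenForcing : Type := FinSeq fun _ : ℕ => Bool

/-- The canonical name for the Cohen real in `2^ω`. -/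
def cohenName : StandardName CohenForcing (fun _ : ℕ => Bool) where
  N _ := 1
  q η _ := η
  antichain := by
    rintro ⟨n, a⟩ ⟨n', b⟩ k m hlen hk hm hne ⟨r, ⟨h₁, h₁'⟩, ⟨h₂, h₂'⟩⟩
    have hk0 : k = 0 := by
      have : k < 1 := by exact_mod_cast hk
      omega
    have hm0 : m = 0 := by
      have : m < 1 := by exact_mod_cast hm
      omega
    subst hk0 hm0
    dsimp only at hlen
    subst hlen
    apply hne
    have hab : a = b := by
      funext i
      exact (h₁' i.1 i.2).trans (h₂' i.1 i.2).symm
    rw [hab]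
  maximal := by
    intro n p
    refine ⟨⟨n, fun i => if h : i.1 < p.len then p.entry ⟨i.1, h⟩ else false⟩, 0, rfl,
      by simp, ⟨⟨max n p.len, fun i => if h : i.1 < p.len then p.entry ⟨i.1, h⟩ else false⟩,
      ⟨le_max_right _ _, ?_⟩, ⟨le_max_left _ _, ?_⟩⟩⟩
    · intro i hi
      simp [hi]
    · intro i hi
      rfl
  coherent := by
    intro ν η k hlt _
    exact ⟨0, by simp, hlt.le⟩

/-! ### Creatures and creating pairs -/

/-- A creature for `H`. Its distinguished component `dis` is a label from some type `D`. -/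
structure Creature (H : ℕ → Type*) (D : Type*) where
  nor : ℝ≥0
  val : Set (FinSeq H × FinSeq H)
  dis : D
  mdn : ℕ
  mup : ℕ
  mdn_lt_mup : mdn < mup
  val_nonempty : val.Nonempty
  val_sub : ∀ x ∈ val, x.1.len = mdn ∧ x.2.len = mup ∧ x.1 < x.2

namespace Creature

variable {H : ℕ → Type*} {D : Type*}

/-- The domain of the relation `val[t]`. -/
def dom (t : Creature H D) : Set (FinSeq H) := {u | ∃ v, (u, v) ∈ t.val}

/-- The set of `i`-th entries of the elements of the range of `val[t]`. If `t` is local and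
forgetful and `i = mdn`, this is the set `pos(t) ⊆ H(mdn)` which determines `val[t]`. -/
def pos (t : Creature H D) (i : ℕ) : Set (H i) :=
  {a | ∃ x ∈ t.val, ∃ h : i < x.2.len, x.2.entry ⟨i, h⟩ = a}

/-- The set `{t a, t (a + 1), …, t (b - 1)}`. -/
def block (t : ℕ → Creature H D) (a b : ℕ) : Finset (Creature H D) := by
  classical exact (Finset.Ico a b).image t

/-- The set `pos(w, t 0, …, t (n - 1))`. -/
def possib (w : FinSeq H) (t : ℕ → Creature H D) : ℕ → Set (FinSeq H)
  | 0 => {w}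
  | n + 1 => {v | v.len = (t n).mup ∧ w < v ∧
      ∀ i ≤ n, (v.res (t i).mdn, v.res (t i).mup) ∈ (t i).val}

end Creature

open Classical in
/-- A creating pair `(K, Σ)` for `H`. Only the values of `Sig` at finite subsets of `K` matter. -/
structure CreatingPair (H : ℕ → Type*) (D : Type*) where
  K : Set (Creature H D)
  Sig : Finset (Creature H D) → Set (Creature H D)
  sig_sub : ∀ S : Finset (Creature H D), ↑S ⊆ K → Sig S ⊆ K
  sig_enum : ∀ S : Finset (Creature H D), ↑S ⊆ K → (Sig S).Nonempty →
    ∃ (k : ℕ) (t : ℕ → Creature H D), Creature.block t 0 (k + 1) = S ∧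
      ∀ i < k, (t i).mup = (t (i + 1)).mdn
  sig_bounds : ∀ (k : ℕ) (t : ℕ → Creature H D), (∀ i ≤ k, t i ∈ K) →
    (∀ i < k, (t i).mup = (t (i + 1)).mdn) → ∀ s ∈ Sig (Creature.block t 0 (k + 1)),
      s.mdn = (t 0).mdn ∧ s.mup = (t k).mup
  sig_self : ∀ t ∈ K, t ∈ Sig {t}
  sig_empty : Sig ∅ = ∅
  sig_trans : ∀ (n : ℕ) (s : ℕ → Creature H D) (S : ℕ → Finset (Creature H D)),
    (∀ i ≤ n, ↑(S i) ⊆ K ∧ s i ∈ Sig (S i)) → (∀ i < n, (s i).mup = (s (i + 1)).mdn) →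
      Sig (Creature.block s 0 (n + 1)) ⊆ Sig ((Finset.range (n + 1)).biUnion S)
  sig_nice : ∀ (k : ℕ) (t : ℕ → Creature H D), (∀ i ≤ k, t i ∈ K) →
    (∀ i < k, (t i).mup = (t (i + 1)).mdn) → ∀ s ∈ Sig (Creature.block t 0 (k + 1)),
      (t 0).dom = s.dom ∧
      ∀ x ∈ s.val, ∀ i ≤ k, (x.2.res (t i).mdn, x.2.res (t i).mup) ∈ (t i).val

namespace CreatingPair

variable {H : ℕ → Type*} {D : Type*}

def IsLocal (C : CreatingPair H D) : Prop := ∀ t ∈ C.K, t.mup = t.mdn + 1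

def IsForgetful (C : CreatingPair H D) : Prop :=
  ∀ t ∈ C.K, ∀ x ∈ t.val, ∀ w : FinSeq H, w.len = t.mdn → (w, w.splice x.2) ∈ t.val

/-- `t` is a creature from `K` with `mdn = i` and `pos(t) = A`. For a complete creating pair and
nonempty `A` there is exactly one such creature, denoted `t^i_A`. -/
def IsAt (C : CreatingPair H D) (i : ℕ) (A : Set (H i)) (t : Creature H D) : Prop :=
  t ∈ C.K ∧ t.mdn = i ∧ t.pos i = A

/-- A complete (local and forgetful) creating pair. -/
def IsComplete (C : CreatingPair H D) : Prop :=
  C.IsLocal ∧ C.IsForgetful ∧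
  (∀ (i : ℕ) (A : Set (H i)), A.Nonempty → ∃! t, C.IsAt i A t) ∧
  ∀ (i : ℕ) (A B : Set (H i)) (s t : Creature H D), A ⊆ B → C.IsAt i A s → C.IsAt i B t →
    s ∈ C.Sig {t} ∧ s.nor ≤ t.nor

/-- An `h`-linked creating pair. -/
def IsLinkedBy (C : CreatingPair H D) (h : ℕ → ℕ → ℕ) : Prop :=
  ∀ k : ℕ, 1 < k → ∀ t₀ ∈ C.K, ∀ t₁ ∈ C.K, (k : ℝ≥0) ≤ t₀.nor → (k : ℝ≥0) ≤ t₁.nor →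
    t₀.mdn = t₁.mdn → t₀.mup = t₁.mup →
      ∃ s ∈ C.Sig {t₀} ∩ C.Sig {t₁}, ((h t₀.mdn k : ℕ) : ℝ≥0) ≤ s.nor

/-- The pure candidates with respect to `(K, Σ)`. -/
def IsPureCandidate (C : CreatingPair H D) (t : ℕ → Creature H D) : Prop :=
  (∀ i, t i ∈ C.K) ∧ (∀ i, (t i).mup = (t (i + 1)).mdn) ∧
  ∃ w ∈ (t 0).dom, ∀ i, Creature.possib w t (i + 1) ⊆ (t (i + 1)).dom

/-- The conditions `(w, t 0, t 1, …)`, without any requirement on the norms. -/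
structure Condition (C : CreatingPair H D) where
  w : FinSeq H
  t : ℕ → Creature H D
  mem : ∀ i, t i ∈ C.K
  consecutive : ∀ i, (t i).mup = (t (i + 1)).mdn
  w_mem : w ∈ (t 0).dom
  pos_sub : ∀ i, Creature.possib w t (i + 1) ⊆ (t (i + 1)).dom

namespace Condition

variable {C : CreatingPair H D}

/-- `q` is a result of deciding the value for `p`. -/
def Decide (p q : Condition C) : Prop :=
  ∃ n : ℕ, q.w ∈ Creature.possib p.w p.t n ∧ ∀ i, q.t i = p.t (n + i)

/-- `q` is a result of applying `Σ` to `p`. -/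
def ApplySig (p q : Condition C) : Prop :=
  q.w = p.w ∧ ∃ n : ℕ → ℕ, n 0 = 0 ∧ StrictMono n ∧
    ∀ i, q.t i ∈ C.Sig (Creature.block p.t (n i) (n (i + 1)))

/-- `q` is obtained from `p` by applying finitely many times the two operations. -/
instance : Preorder (Condition C) where
  le := Relation.ReflTransGen fun p q => Decide p q ∨ ApplySig p q
  le_refl _ := Relation.ReflTransGen.refl
  le_trans _ _ _ := Relation.ReflTransGen.trans

end Condition

/-- The forcing notion `Q*_𝓕(K, Σ)`: the conditions `(w, t 0, t 1, …)` such that for some `f ∈ 𝓕`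
we have `nor[t i] ≥ f(mdn[t i])` for all but finitely many `i`. -/
abbrev QStar (C : CreatingPair H D) (F : Set (ℕ → ℕ)) : Type _ :=
  {p : Condition C // ∃ f ∈ F, ∀ᶠ i in atTop, ((f (p.t i).mdn : ℕ) : ℝ≥0) ≤ (p.t i).nor}

/-- The coding of conditions by points `(w, val[t 0], val[t 1], …)` of a Polish space; subsets of
the countable set of pairs of finite sequences are identified with their characteristic
functions. -/
def QStar.code (C : CreatingPair H D) (F : Set (ℕ → ℕ)) (p : QStar C F) :
    FinSeq H × (ℕ → FinSeq H × FinSeq H → Bool) :=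
  (p.1.w, fun i x => by classical exact decide (x ∈ (p.1.t i).val))

/-- The function `A ↦ nor[t^n_A]` has `Σ¹₁` superlevel sets, for each `n`. (This holds trivially
if `H(n)` is finite, since then there are finitely many sets `A`.) -/
def HasAnalyticNorms (C : CreatingPair H D) : Prop :=
  ∀ n j : ℕ, MeasureTheory.AnalyticSet
    {c : H n → Bool | ∃ t, C.IsAt n {a | c a = true} t ∧ (j : ℝ≥0) ≤ t.nor}

end CreatingPair

/-! ### Functions, and sourness systems -/

/-- Regressive functions. -/
def IsRegressive (h : ℕ → ℕ → ℕ) : Prop :=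
  ∀ m : ℕ, (∀ k, 1 < k → 1 ≤ h m k ∧ h m k < k) ∧ ∀ k l, k < l → h m k ≤ h m l

/-- `h`-closed families. -/
def IsClosedUnderRegression (h : ℕ → ℕ → ℕ) (F : Set (ℕ → ℕ)) : Prop :=
  ∀ f ∈ F, ∃ f' ∈ F, ∀ᶠ n in atTop, f' n ≤ h n (f n)

/-- `≥*`-directed families. -/
def IsGeStarDirected (F : Set (ℕ → ℕ)) : Prop :=
  ∀ f₀ ∈ F, ∀ f₁ ∈ F, ∃ f' ∈ F, ∀ᶠ n in atTop, f' n ≤ min (f₀ n) (f₁ n)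

/-- `(g, ℓ)` is a sourness system for `(K, Σ, 𝓕)`. For `ρ ∈ 2^k`, only the values of
`g k ρ` at `i < ℓ k` matter, so `g k ρ` represents an element of `∏_{i < ℓ k} 𝒫(H(i))`. -/
structure IsSournessSystem {H : ℕ → Type*} {D : Type*} (C : CreatingPair H D) (F : Set (ℕ → ℕ))
    (g : ∀ k : ℕ, (Fin k → Bool) → ∀ i : ℕ, Set (H i)) (ℓ : ℕ → ℕ) : Prop where
  increasing : StrictMono ℓ
  coherent : ∀ (k k' : ℕ) (hk : k ≤ k') (ρ : Fin k → Bool) (ρ' : Fin k' → Bool),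
    (∀ j : Fin k, ρ j = ρ' (Fin.castLE hk j)) → ∀ i < ℓ k, g k ρ i = g k' ρ' i
  nonempty : ∀ k n, ℓ k ≤ n → n < ℓ (k + 1) → ∀ ρ, (g (k + 1) ρ n).Nonempty
  disjoint : ∀ k n, ℓ k ≤ n → n < ℓ (k + 1) → ∀ ρ ρ', ρ ≠ ρ' →
    Disjoint (g (k + 1) ρ n) (g (k + 1) ρ' n)
  room : ∀ k n, ℓ k ≤ n → n < ℓ (k + 1) → (univ \ ⋃ ρ, g (k + 1) ρ n).Nonempty
  few_missing : ∀ f ∈ F, ∀ (t : ℕ → Creature H D) (k₀ : ℕ), C.IsPureCandidate t →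
    (t 0).mdn = ℓ k₀ → (∀ n, ((f (n + ℓ k₀) : ℕ) : ℝ≥0) ≤ (t n).nor) →
      ∃ N : ℕ, ∀ k ≥ k₀,
        {ρ : Fin (k + 1) → Bool | {n : ℕ | ℓ k ≤ n ∧ n < ℓ (k + 1) ∧
          (g (k + 1) ρ n ∩ (t (n - ℓ k₀)).pos n).Nonempty}.ncard < 2 ^ (k + 1)}.ncard ≤ N
  not_covered : ∀ f ∈ F, ∀ (t : ℕ → Creature H D) (k₀ : ℕ), C.IsPureCandidate t →
    (t 0).mdn = ℓ k₀ → (∀ n, ((f (n + ℓ k₀) : ℕ) : ℝ≥0) ≤ (t n).nor) →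
      ∃ k₁ ≥ k₀, ∀ k ≥ k₁, ∀ n, ℓ k ≤ n → n < ℓ (k + 1) →
        ((t (n - ℓ k₀)).pos n \ ⋃ ρ, g (k + 1) ρ n).Nonempty

end

/-!
For a complete creating pair a condition amounts to the length of its stem together with the sets
`poss p n` of the values which the generic sequence `W` may take at `n`; these are singletons below
the length of the stem, and `p ≤ q` means that the stem gets longer and the sets get smaller
(`CreatingPair.QStar.le_iff`). Since the pair is linked and the family is directed and `h`-closed,
two conditions are compatible as soon as their sets of possibilities meet everywhere
(`compat_iff`). This gives the ccc, because there are countably many pairs of a stem and a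
function of the family (`isCCC`). It also makes incompatibility Borel relative to the set of
conditions, and so the forcing notion is Souslin (`isSouslin`).

For sourness, say that `W` hits a node `ρ` of level `K`, that is, `ρ ∈ 2^(K+1)`, if
`W n ∈ g_ρ(n)` for some `n` in the block `[ℓ K, ℓ (K+1))`. The `m`-th bit of the real `τ j` is `j`
if there are two branches `x`, `y` which split at `m` and which `W` hits on no even level `K ≥ m`;
otherwise it tells whether `W` hits some node of the odd level `2m + 1`. The predense families
consist of the conditions which have a given stem and say beyond it just that `W` does not hit the
given branch. A common extension of two such conditions, for branches that split at `m`, forces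
the `m`-th bit of `τ j` to be `j`, provided that the stem does not exceed `ℓ m`
(`avoidsSplit_of_isBranchCondition`); so it separates `τ 0` from `τ 1`.

It remains to see that these reals are Cohen. Every condition has an extension `q` which on each
level avoids a bounded number `N` of nodes altogether, whereas each other node can be hit in
as many places as the level has nodes (`exists_ge_isNormal`). As a pair of splitting branches
determines its splitting point, there are at most `N²` bits which are set because `q` avoids two
branches (`finite_avoidsSplit`). All later bits are free (`IsNormal.exists_decidesBit`): on
the odd levels code the bits that are wanted, and on the even levels hit all nodes that are not
avoided, which is possible by Hall's theorem. By compactness finitely many levels are enough to hit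
one of any two branches splitting at one of the places in question. Finally, a real with such free
bits has a standard name, built from a refining sequence of maximal antichains, and
`RO(2^{<ω})` is embedded completely into `RO(P)` by mapping a regular open set to the Boolean value
of the statement that it contains an initial segment of the real
(`IsCohenDecision.isCopyOf_cohenName`).
-/

/-! ### Conditions as trees of possibilities -/

namespace FinSeq

variable {H : ℕ → Type*}

theorem ext_entry {u v : FinSeq H} (hlen : u.len = v.len)
    (h : ∀ (i : ℕ) (hi : i < u.len) (hi' : i < v.len), u.entry ⟨i, hi⟩ = v.entry ⟨i, hi'⟩) :
    u = v := by
  obtain ⟨n, a⟩ := u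
  obtain ⟨n', b⟩ := v
  dsimp only at hlen
  subst hlen
  congr 1
  funext i
  exact h i.1 i.2 i.2

theorem lt_of_le_of_len_lt {u v : FinSeq H} (h : u ≤ v) (hlen : u.len < v.len) : u < v :=
  lt_of_le_not_ge h fun h' => absurd h'.1 (by omega)

theorem eq_of_le_of_len_eq {u v : FinSeq H} (h : u ≤ v) (hlen : u.len = v.len) : u = v :=
  ext_entry hlen fun i hi _ => h.2 i hi

theorem entry_mem_congr {v : FinSeq H} {A : ∀ n, Set (H n)} {i j : ℕ} (hij : i = j)
    (hi : i < v.len) (hj : j < v.len) : v.entry ⟨i, hi⟩ ∈ A i ↔ v.entry ⟨j, hj⟩ ∈ A j := by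
  subst hij
  rfl

theorem res_entry {v : FinSeq H} {m i : ℕ} (h : i < (v.res m).len) :
    (v.res m).entry ⟨i, h⟩ = v.entry ⟨i, h.trans_le (min_le_right _ _)⟩ := rfl

instance [∀ n, Countable (H n)] : Countable (FinSeq H) := by
  have : Function.Injective (fun u : FinSeq H => (⟨u.len, u.entry⟩ : Σ n, ∀ i : Fin n, H i)) := by
    rintro ⟨n, a⟩ ⟨m, b⟩ hab
    simp only [Sigma.mk.injEq] at hab
    obtain ⟨rfl, hab⟩ := hab
    rw [eq_of_heq hab]
  exact this.countable

end FinSeq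

namespace CreatingPair

variable {H : ℕ → Type*} {D : Type*} {C : CreatingPair H D}

theorem block_succ (t : ℕ → Creature H D) (i : ℕ) : Creature.block t i (i + 1) = {t i} := by
  classical
  unfold Creature.block
  ext x
  simp

theorem block_shift (t : ℕ → Creature H D) (a k : ℕ) :
    Creature.block (fun i => t (a + i)) 0 k = Creature.block t a (a + k) := by
  classical
  unfold Creature.block
  ext x
  simp only [Finset.mem_image, Finset.mem_Ico]
  constructor
  · rintro ⟨i, hi, rfl⟩
    exact ⟨a + i, by omega, rfl⟩
  · rintro ⟨i, hi, rfl⟩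
    exact ⟨i - a, by omega, by congr 1; omega⟩

/-- In a local forgetful creating pair a creature is determined by its set of possibilities. -/
theorem mem_val_iff (hC : C.IsComplete) {t : Creature H D} (ht : t ∈ C.K)
    (x : FinSeq H × FinSeq H) :
    x ∈ t.val ↔ x.1.len = t.mdn ∧ x.2.len = t.mdn + 1 ∧ x.1 ≤ x.2 ∧
      ∃ h : t.mdn < x.2.len, x.2.entry ⟨t.mdn, h⟩ ∈ t.pos t.mdn := by
  have hup := hC.1 t ht
  constructor
  · intro hx
    obtain ⟨h1, h2, h3⟩ := t.val_sub x hx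
    have : t.mdn < x.2.len := by omega
    exact ⟨h1, by omega, h3.le, this, x, hx, this, rfl⟩
  · rintro ⟨h1, h2, h3, h4, y, hy, h5, h6⟩
    obtain ⟨h7, h8, h9⟩ := t.val_sub y hy
    have key := hC.2.1 t ht y hy x.1 h1
    have : x.1.splice y.2 = x.2 := by
      refine FinSeq.ext_entry (by simp only [FinSeq.splice]; omega) fun i hi hi' => ?_
      simp only [FinSeq.splice]
      split_ifs with hlt
      · exact h3.2 i hlt
      · have : i = t.mdn := by omega
        subst this
        exact h6
    rw [this] at key
    exact key

theorem mem_dom_iff (hC : C.IsComplete) {t : Creature H D} (ht : t ∈ C.K) (u : FinSeq H) :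
    u ∈ t.dom ↔ u.len = t.mdn := by
  constructor
  · rintro ⟨v, hv⟩
    exact (t.val_sub _ hv).1
  · intro hu
    obtain ⟨x, hx⟩ := t.val_nonempty
    exact ⟨_, hC.2.1 t ht x hx u hu⟩

theorem pos_nonempty (hC : C.IsComplete) {t : Creature H D} (ht : t ∈ C.K) :
    (t.pos t.mdn).Nonempty := by
  obtain ⟨x, hx⟩ := t.val_nonempty
  obtain ⟨_, _, _, _, h⟩ := (mem_val_iff hC ht x).1 hx
  exact ⟨_, h⟩

theorem isAt_self {t : Creature H D} (ht : t ∈ C.K) : C.IsAt t.mdn (t.pos t.mdn) t :=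
  ⟨ht, rfl, rfl⟩

theorem sig_singleton {s t : Creature H D} (ht : t ∈ C.K) (hs : s ∈ C.Sig {t}) :
    s ∈ C.K ∧ s.mdn = t.mdn ∧ s.mup = t.mup ∧
      ∀ x ∈ s.val, (x.2.res t.mdn, x.2.res t.mup) ∈ t.val := by
  have hb : Creature.block (fun _ => t) 0 (0 + 1) = {t} := block_succ _ 0
  have hK : s ∈ C.K := C.sig_sub {t} (by simpa using ht) hs
  rw [← hb] at hs
  have h1 := C.sig_bounds 0 (fun _ => t) (fun _ _ => ht) (by simp) s hs
  have h2 := C.sig_nice 0 (fun _ => t) (fun _ _ => ht) (by simp) s hs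
  exact ⟨hK, h1.1, h1.2, fun x hx => h2.2 x hx 0 le_rfl⟩

/-- For a complete creating pair, `Σ({t})` consists of the creatures with fewer possibilities. -/
theorem mem_sig_singleton_iff (hC : C.IsComplete) {s t : Creature H D} (hs : s ∈ C.K)
    (ht : t ∈ C.K) :
    s ∈ C.Sig {t} ↔ s.mdn = t.mdn ∧ s.pos s.mdn ⊆ t.pos s.mdn := by
  constructor
  · intro h
    obtain ⟨-, h1, h2, h3⟩ := sig_singleton ht h
    refine ⟨h1, ?_⟩
    rintro a ⟨x, hx, hlt, rfl⟩
    have h4 := h3 x hx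
    have h5 := (s.val_sub x hx).2.1
    have := hC.1 t ht
    refine ⟨_, h4, ?_, rfl⟩
    simp only [FinSeq.res]
    omega
  · rintro ⟨h1, h2⟩
    refine (hC.2.2.2 s.mdn _ _ s t h2 (isAt_self hs) ⟨ht, h1.symm, rfl⟩).1

/-- The norm of the unique creature `t^n_A` (and `0` if there is no such creature). -/
noncomputable def setNorm (C : CreatingPair H D) (n : ℕ) (A : Set (H n)) : ℝ≥0 := by
  classical exact if h : ∃ t, C.IsAt n A t then h.choose.nor else 0

theorem isAt_unique (hC : C.IsComplete) {n : ℕ} {A : Set (H n)} {s t : Creature H D}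
    (hs : C.IsAt n A s) (ht : C.IsAt n A t) : s = t := by
  have hA : A.Nonempty := by
    obtain ⟨h1, rfl, rfl⟩ := hs
    exact pos_nonempty hC h1
  exact (hC.2.2.1 n A hA).unique hs ht

theorem setNorm_eq (hC : C.IsComplete) {n : ℕ} {A : Set (H n)} {t : Creature H D}
    (ht : C.IsAt n A t) : C.setNorm n A = t.nor := by
  have h : ∃ t, C.IsAt n A t := ⟨t, ht⟩
  unfold setNorm
  rw [dif_pos h, isAt_unique hC h.choose_spec ht]

theorem nonempty_of_setNorm_pos (hC : C.IsComplete) {n : ℕ} {A : Set (H n)}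
    (h : 0 < C.setNorm n A) : A.Nonempty := by
  unfold setNorm at h
  split_ifs at h with h'
  · obtain ⟨t, h1, rfl, rfl⟩ := h'
    exact pos_nonempty hC h1
  · exact absurd h (lt_irrefl _)

theorem setNorm_mono (hC : C.IsComplete) {n : ℕ} {A B : Set (H n)} (hA : A.Nonempty)
    (hAB : A ⊆ B) : C.setNorm n A ≤ C.setNorm n B := by
  obtain ⟨s, hs, -⟩ := hC.2.2.1 n A hA
  obtain ⟨t, ht, -⟩ := hC.2.2.1 n B (hA.mono hAB)
  rw [setNorm_eq hC hs, setNorm_eq hC ht]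
  exact (hC.2.2.2 n A B s t hAB hs ht).2

theorem setNorm_inter (hC : C.IsComplete) {h : ℕ → ℕ → ℕ} (hlink : C.IsLinkedBy h) {n k : ℕ}
    (hk : 1 < k) {A B : Set (H n)} (hA : (k : ℝ≥0) ≤ C.setNorm n A)
    (hB : (k : ℝ≥0) ≤ C.setNorm n B) :
    (A ∩ B).Nonempty ∧ ((h n k : ℕ) : ℝ≥0) ≤ C.setNorm n (A ∩ B) := by
  have hk0 : (0 : ℝ≥0) < k := by exact_mod_cast (by omega : 0 < k)
  obtain ⟨s, hs, -⟩ := hC.2.2.1 n A (nonempty_of_setNorm_pos hC (hk0.trans_le hA))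
  obtain ⟨t, ht, -⟩ := hC.2.2.1 n B (nonempty_of_setNorm_pos hC (hk0.trans_le hB))
  rw [setNorm_eq hC hs] at hA
  rw [setNorm_eq hC ht] at hB
  have e1 := hs.2.1
  have e2 := ht.2.1
  have u1 := hC.1 s hs.1
  have u2 := hC.1 t ht.1
  obtain ⟨r, hr, hr'⟩ := hlink k hk s hs.1 t ht.1 hA hB (by omega) (by omega)
  have hrK := (sig_singleton hs.1 hr.1).1
  have h1 := (mem_sig_singleton_iff hC hrK hs.1).1 hr.1
  have h2 := (mem_sig_singleton_iff hC hrK ht.1).1 hr.2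
  obtain ⟨hsK, rfl, rfl⟩ := hs
  obtain ⟨htK, e, rfl⟩ := ht
  have key : C.IsAt s.mdn (r.pos s.mdn) r := ⟨hrK, h1.1, rfl⟩
  have hne := pos_nonempty hC hrK
  have e3 := h1.1
  rw [e3] at h1 h2 hne
  have hsub : r.pos s.mdn ⊆ s.pos s.mdn ∩ t.pos s.mdn := subset_inter h1.2 h2.2
  refine ⟨hne.mono hsub, hr'.trans ?_⟩
  rw [← setNorm_eq hC key]
  exact setNorm_mono hC hne hsub

namespace Condition

theorem mdn_eq (hC : C.IsComplete) (p : Condition C) (i : ℕ) :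
    (p.t i).mdn = p.w.len + i := by
  induction i with
  | zero => exact ((mem_dom_iff hC (p.mem 0) p.w).1 p.w_mem).symm
  | succ i ih => rw [← p.consecutive i, hC.1 _ (p.mem i), ih, add_assoc]

/-- A stem followed by creatures at the right places is a condition. -/
def ofCreatures (hC : C.IsComplete) (w : FinSeq H) (t : ℕ → Creature H D)
    (hK : ∀ i, t i ∈ C.K) (hmdn : ∀ i, (t i).mdn = w.len + i) : Condition C where
  w := w
  t := t
  mem := hK
  consecutive i := by rw [hC.1 _ (hK i), hmdn, hmdn, add_assoc]
  w_mem := (mem_dom_iff hC (hK 0) w).2 (hmdn 0).symm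
  pos_sub i v hv := by
    rw [mem_dom_iff hC (hK (i + 1)), hv.1, hC.1 _ (hK i), hmdn, hmdn, add_assoc]

/-- The set of the values which the generic sequence may take at `n`: a singleton if `n` is in
the domain of the stem, and the set of possibilities of a creature otherwise. -/
def poss (p : Condition C) (n : ℕ) : Set (H n) :=
  if h : n < p.w.len then {p.w.entry ⟨n, h⟩} else (p.t (n - p.w.len)).pos n

theorem poss_of_lt (p : Condition C) {n : ℕ} (h : n < p.w.len) :
    p.poss n = {p.w.entry ⟨n, h⟩} := dif_pos h

theorem poss_of_le (p : Condition C) {n : ℕ} (h : p.w.len ≤ n) :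
    p.poss n = (p.t (n - p.w.len)).pos n := dif_neg (not_lt.2 h)

theorem poss_add (p : Condition C) (i : ℕ) :
    p.poss (p.w.len + i) = (p.t i).pos (p.w.len + i) := by
  rw [poss_of_le p (Nat.le_add_right _ _), Nat.add_sub_cancel_left]

theorem isAt_poss (hC : C.IsComplete) (p : Condition C) (i : ℕ) :
    C.IsAt (p.w.len + i) (p.poss (p.w.len + i)) (p.t i) :=
  ⟨p.mem i, mdn_eq hC p i, (poss_add p i).symm⟩

theorem poss_nonempty (hC : C.IsComplete) (p : Condition C) (n : ℕ) : (p.poss n).Nonempty := by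
  rcases lt_or_ge n p.w.len with h | h
  · rw [poss_of_lt p h]
    exact singleton_nonempty _
  · obtain ⟨i, rfl⟩ := Nat.exists_eq_add_of_le h
    rw [poss_add, ← mdn_eq hC]
    exact pos_nonempty hC (p.mem i)

theorem poss_subsingleton (p : Condition C) {n : ℕ} (h : n < p.w.len) :
    (p.poss n).Subsingleton := by
  rw [poss_of_lt p h]
  exact subsingleton_singleton

theorem poss_injective (hC : C.IsComplete) {p q : Condition C} (hlen : p.w.len = q.w.len)
    (h : ∀ n, p.poss n = q.poss n) : p = q := by
  have hw : p.w = q.w := by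
    refine FinSeq.ext_entry hlen fun i hi hi' => ?_
    have := h i
    rw [poss_of_lt p hi, poss_of_lt q hi'] at this
    exact singleton_injective this
  have ht : p.t = q.t := by
    funext i
    have h1 := isAt_poss hC p i
    have h2 := isAt_poss hC q i
    rw [h, hlen] at h1
    exact isAt_unique hC h1 h2
  cases p
  cases q
  simp only at hw ht
  subst hw ht
  rfl

theorem exists_poss_eq (hC : C.IsComplete) (L : ℕ) (A : ∀ n, Set (H n))
    (hA : ∀ n, (A n).Nonempty) (hL : ∀ n < L, (A n).Subsingleton) :
    ∃ p : Condition C, p.w.len = L ∧ ∀ n, p.poss n = A n := by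
  choose a ha using hA
  choose t ht using fun i => (hC.2.2.1 (L + i) (A (L + i)) ⟨_, ha _⟩).exists
  refine ⟨ofCreatures hC ⟨L, fun i => a i⟩ t (fun i => (ht i).1) (fun i => (ht i).2.1), rfl,
    fun n => ?_⟩
  rcases lt_or_ge n L with h | h
  · rw [poss_of_lt _ h]
    exact (((hL n h).eq_singleton_of_mem (ha n))).symm
  · obtain ⟨i, rfl⟩ := Nat.exists_eq_add_of_le h
    exact (poss_add _ i).trans (ht i).2.2

theorem mem_possib (hC : C.IsComplete) (p : Condition C) (n : ℕ) (v : FinSeq H) :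
    v ∈ Creature.possib p.w p.t n ↔ v.len = p.w.len + n ∧
      ∀ i (hi : i < v.len), v.entry ⟨i, hi⟩ ∈ p.poss i := by
  cases n with
  | zero =>
    constructor
    · rintro rfl
      exact ⟨rfl, fun i hi => by rw [poss_of_lt p hi]; rfl⟩
    · rintro ⟨h1, h2⟩
      refine FinSeq.ext_entry h1 fun i hi hi' => ?_
      have := h2 i hi
      rwa [poss_of_lt p hi'] at this
  | succ n =>
    have hup : (p.t n).mup = p.w.len + (n + 1) := by
      rw [hC.1 _ (p.mem n), mdn_eq hC, add_assoc]
    constructor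
    · rintro ⟨h1, h2, h3⟩
      refine ⟨h1.trans hup, fun i hi => ?_⟩
      rcases lt_or_ge i p.w.len with h | h
      · rw [poss_of_lt p h]
        exact (h2.le.2 i h).symm
      · obtain ⟨j, rfl⟩ := Nat.exists_eq_add_of_le h
        obtain ⟨-, -, -, h4, h5⟩ := (mem_val_iff hC (p.mem j) _).1 (h3 j (by omega))
        rw [poss_add]
        have e := mdn_eq hC p j
        rw [FinSeq.res_entry] at h5
        exact (FinSeq.entry_mem_congr (A := (p.t j).pos) e _ hi).1 h5
    · rintro ⟨h1, h2⟩
      have hle : p.w ≤ v := by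
        refine ⟨by omega, fun i hi => ?_⟩
        have := h2 i (by omega)
        rw [poss_of_lt p hi] at this
        exact this.symm
      refine ⟨h1.trans hup.symm, FinSeq.lt_of_le_of_len_lt hle (by omega), fun j hj => ?_⟩
      have e := mdn_eq hC p j
      have hupj : (p.t j).mup = p.w.len + j + 1 := by rw [hC.1 _ (p.mem j), e]
      rw [mem_val_iff hC (p.mem j)]
      refine ⟨?_, ?_, ⟨?_, fun i hi => rfl⟩, ?_, ?_⟩
      · simp only [FinSeq.res]; omega
      · simp only [FinSeq.res]; omega
      · simp only [FinSeq.res]; omega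
      · simp only [FinSeq.res]; omega
      · rw [FinSeq.res_entry]
        have h3 := h2 (p.w.len + j) (by omega)
        rw [poss_add] at h3
        exact (FinSeq.entry_mem_congr (A := (p.t j).pos) e _ _).2 h3

theorem ApplySig.t_mem_sig (hC : C.IsComplete) {p q : Condition C} (h : ApplySig p q) (i : ℕ) :
    q.t i ∈ C.Sig {p.t i} := by
  obtain ⟨hw, n, h0, hn, hs⟩ := h
  have hni : ∀ i, n i = i := by
    intro i
    have h1 := hs i
    have hlt : n i < n (i + 1) := hn (Nat.lt_succ_self i)
    have e : n (i + 1) = n i + ((n (i + 1) - n i - 1) + 1) := by omega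
    rw [e, ← block_shift] at h1
    have h2 := (C.sig_bounds _ (fun j => p.t (n i + j)) (fun j _ => p.mem _)
      (fun j _ => p.consecutive _) _ h1).1
    rw [mdn_eq hC, mdn_eq hC, hw] at h2
    omega
  have := hs i
  rwa [hni, hni, block_succ] at this

/-- The order of conditions: the stem gets longer and there are fewer possibilities. -/
theorem le_iff (hC : C.IsComplete) {p q : Condition C} :
    p ≤ q ↔ p.w.len ≤ q.w.len ∧ ∀ n, q.poss n ⊆ p.poss n := by
  constructor
  · intro hpq
    change Relation.ReflTransGen _ p q at hpq
    induction hpq with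
    | refl => exact ⟨le_rfl, fun _ => subset_rfl⟩
    | @tail q r _ hqr ih =>
      suffices h : q.w.len ≤ r.w.len ∧ ∀ n, r.poss n ⊆ q.poss n from
        ⟨ih.1.trans h.1, fun n => (h.2 n).trans (ih.2 n)⟩
      rcases hqr with ⟨k, hk, hk'⟩ | h
      · rw [mem_possib hC] at hk
        refine ⟨by omega, fun n => ?_⟩
        rcases lt_or_ge n r.w.len with hn | hn
        · rw [poss_of_lt r hn]
          exact singleton_subset_iff.2 (hk.2 n hn)
        · rw [poss_of_le r hn, poss_of_le q (by omega), hk']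
          rw [show k + (n - r.w.len) = n - q.w.len by omega]
      · have hw := h.1
        refine ⟨by rw [hw], fun n => ?_⟩
        rcases lt_or_ge n r.w.len with hn | hn
        · rw [poss_of_lt r hn, singleton_subset_iff, poss_of_lt q (by rw [← hw]; exact hn)]
          exact (le_of_eq hw).2 n hn
        · obtain ⟨i, rfl⟩ := Nat.exists_eq_add_of_le hn
          have h1 := (mem_sig_singleton_iff hC (r.mem i) (q.mem i)).1 (h.t_mem_sig hC i)
          rw [poss_add, show q.poss (r.w.len + i) = (q.t i).pos (r.w.len + i) by
            rw [hw]; exact poss_add q i, ← mdn_eq hC r i]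
          exact h1.2
  · rintro ⟨hlen, hsub⟩
    let k := q.w.len - p.w.len
    let r : Condition C := ofCreatures hC q.w (fun i => p.t (k + i)) (fun i => p.mem _)
      (fun i => by rw [mdn_eq hC]; omega)
    have hpr : Decide p r := by
      refine ⟨k, (mem_possib hC p k _).2 ⟨?_, fun i hi => ?_⟩, fun i => rfl⟩
      · change q.w.len = _
        omega
      · refine hsub i ?_
        rw [poss_of_lt q hi]
        rfl
    have hrq : ApplySig r q := by
      refine ⟨rfl, id, rfl, strictMono_id, fun i => ?_⟩
      simp only [id]
      rw [block_succ, mem_sig_singleton_iff hC (q.mem i) (r.mem i)]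
      have h1 := hsub (q.w.len + i)
      rw [poss_add, poss_of_le p (by omega),
        show q.w.len + i - p.w.len = k + i by omega] at h1
      refine ⟨by rw [mdn_eq hC, mdn_eq hC]; rfl, ?_⟩
      rw [mdn_eq hC]
      exact h1
    have h1 : p ≤ r := Relation.ReflTransGen.single (Or.inl hpr)
    have h2 : r ≤ q := Relation.ReflTransGen.single (Or.inr hrq)
    exact h1.trans h2

end Condition

/-! ### The forcing notion in terms of possibilities -/

namespace QStar

variable {F : Set (ℕ → ℕ)}

/-- The length of the stem of a condition. -/
def len (p : QStar C F) : ℕ := p.1.w.len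

/-- The set of the values which the generic sequence may take at `n`. -/
def poss (p : QStar C F) (n : ℕ) : Set (H n) := p.1.poss n

theorem le_iff (hC : C.IsComplete) {p q : QStar C F} :
    p ≤ q ↔ p.len ≤ q.len ∧ ∀ n, q.poss n ⊆ p.poss n :=
  Condition.le_iff hC

theorem poss_nonempty (hC : C.IsComplete) (p : QStar C F) (n : ℕ) : (p.poss n).Nonempty :=
  Condition.poss_nonempty hC p.1 n

theorem poss_subsingleton (p : QStar C F) {n : ℕ} (h : n < p.len) : (p.poss n).Subsingleton :=
  Condition.poss_subsingleton p.1 h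

theorem poss_eq_of_le (hC : C.IsComplete) {p q : QStar C F} (h : p ≤ q) {n : ℕ}
    (hn : n < p.len) : q.poss n = p.poss n := by
  obtain ⟨a, ha⟩ := q.poss_nonempty hC n
  have hsub := ((le_iff hC).1 h).2 n
  exact hsub.antisymm fun b hb => (p.poss_subsingleton hn hb (hsub ha)) ▸ ha

theorem norm_iff (hC : C.IsComplete) (p : Condition C) (f : ℕ → ℕ) :
    (∀ᶠ i in atTop, ((f (p.t i).mdn : ℕ) : ℝ≥0) ≤ (p.t i).nor) ↔
      ∀ᶠ n in atTop, ((f n : ℕ) : ℝ≥0) ≤ C.setNorm n (p.poss n) := by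
  have key : ∀ i, ((f (p.t i).mdn : ℕ) : ℝ≥0) ≤ (p.t i).nor ↔
      ((f (p.w.len + i) : ℕ) : ℝ≥0) ≤ C.setNorm (p.w.len + i) (p.poss (p.w.len + i)) := by
    intro i
    rw [setNorm_eq hC (p.isAt_poss hC i), Condition.mdn_eq hC]
  simp only [key, eventually_atTop]
  constructor
  · rintro ⟨a, ha⟩
    refine ⟨p.w.len + a, fun n hn => ?_⟩
    have := ha (n - p.w.len) (by omega)
    rwa [show p.w.len + (n - p.w.len) = n by omega] at this
  · rintro ⟨a, ha⟩
    exact ⟨a, fun i hi => ha _ (by omega)⟩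

theorem exists_norm_le (hC : C.IsComplete) (p : QStar C F) :
    ∃ f ∈ F, ∃ a, ∀ n ≥ a, ((f n : ℕ) : ℝ≥0) ≤ C.setNorm n (p.poss n) := by
  obtain ⟨f, hf, h⟩ := p.2
  exact ⟨f, hf, eventually_atTop.1 ((norm_iff hC p.1 f).1 h)⟩

theorem exists_poss_eq (hC : C.IsComplete) (L : ℕ) (A : ∀ n, Set (H n))
    (hA : ∀ n, (A n).Nonempty) (hL : ∀ n < L, (A n).Subsingleton)
    (hF : ∃ f ∈ F, ∃ a, ∀ n ≥ a, ((f n : ℕ) : ℝ≥0) ≤ C.setNorm n (A n)) :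
    ∃ p : QStar C F, p.len = L ∧ ∀ n, p.poss n = A n := by
  obtain ⟨p, h1, h2⟩ := Condition.exists_poss_eq hC L A hA hL
  obtain ⟨f, hf, h⟩ := hF
  refine ⟨⟨p, f, hf, (norm_iff hC p f).2 ?_⟩, h1, h2⟩
  simp only [h2]
  exact eventually_atTop.2 h

theorem poss_injective (hC : C.IsComplete) {p q : QStar C F} (hlen : p.len = q.len)
    (h : ∀ n, p.poss n = q.poss n) : p = q :=
  Subtype.ext (Condition.poss_injective hC hlen h)

end QStar

end CreatingPair

/-! ### Names for Cohen reals -/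

section CohenNames

/-- A countable set is enumerated without repetitions by an initial segment of `ω`. -/
theorem exists_enumeration {α : Type*} [Nonempty α] {S : Set α} (hS : S.Countable) :
    ∃ (N : ℕ∞) (q : ℕ → α), (∀ k : ℕ, (k : ℕ∞) < N → q k ∈ S) ∧
      (∀ k m : ℕ, (k : ℕ∞) < N → (m : ℕ∞) < N → q k = q m → k = m) ∧
      ∀ a ∈ S, ∃ k : ℕ, (k : ℕ∞) < N ∧ q k = a := by
  classical
  obtain ⟨a₀⟩ := ‹Nonempty α›
  rcases S.finite_or_infinite with hfin | hinf
  · have := hfin.to_subtype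
    obtain ⟨n, ⟨e⟩⟩ := Finite.exists_equiv_fin S
    refine ⟨n, fun k => if h : k < n then e.symm ⟨k, h⟩ else a₀,
      fun k hk => ?_, fun k m hk hm h => ?_, fun a ha => ⟨e ⟨a, ha⟩, ?_, ?_⟩⟩
    · have hk' : k < n := by exact_mod_cast hk
      simp [hk']
    · have hk' : k < n := by exact_mod_cast hk
      have hm' : m < n := by exact_mod_cast hm
      simp only [hk', hm', dif_pos] at h
      simpa using e.symm.injective (Subtype.ext h)
    · exact_mod_cast (e ⟨a, ha⟩).2
    · simp
  · have := hS.to_subtype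
    have := hinf.to_subtype
    obtain ⟨hden⟩ := nonempty_denumerable S
    let e := Denumerable.eqv S
    refine ⟨⊤, fun k => e.symm k, fun k _ => (e.symm k).2, fun k m _ _ h => ?_,
      fun a ha => ⟨e ⟨a, ha⟩, ENat.natCast_lt_top _, by simp⟩⟩
    exact e.symm.injective (Subtype.ext h)

variable {P : Type*} [Preorder P]

/-- A dense set contains a maximal antichain of the forcing notion. -/
theorem exists_maximal_antichain_subset (D : Set P) (hD : ∀ p, ∃ q ∈ D, p ≤ q) :
    ∃ A ⊆ D, (∀ p ∈ A, ∀ q ∈ A, p ≠ q → ¬ Compat p q) ∧ ∀ p, ∃ a ∈ A, Compat p a := by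
  obtain ⟨A, hA⟩ := zorn_subset {A : Set P | A ⊆ D ∧ ∀ p ∈ A, ∀ q ∈ A, p ≠ q → ¬ Compat p q}
    (fun c hc hchain => by
      refine ⟨⋃₀ c, ⟨sUnion_subset fun B hB => (hc hB).1, ?_⟩, fun B hB => subset_sUnion_of_mem hB⟩
      rintro p ⟨B, hB, hp⟩ q ⟨B', hB', hq⟩ hpq
      rcases hchain.total hB hB' with h | h
      · exact (hc hB').2 p (h hp) q hq hpq
      · exact (hc hB).2 p hp q (h hq) hpq)
  refine ⟨A, hA.prop.1, hA.prop.2, fun p => ?_⟩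
  obtain ⟨q, hqD, hpq⟩ := hD p
  by_contra! hcon
  have hq : ∀ a ∈ A, ¬ Compat q a := fun a ha ⟨r, h1, h2⟩ =>
    hcon a ha ⟨r, hpq.trans h1, h2⟩
  have hins : insert q A ⊆ A := by
    refine hA.le_of_ge ⟨insert_subset hqD hA.prop.1, ?_⟩ (subset_insert q A)
    rintro a (rfl | ha) b (rfl | hb) hab
    · exact absurd rfl hab
    · exact hq b hb
    · exact fun ⟨r, h1, h2⟩ => hq a ha ⟨r, h2, h1⟩
    · exact hA.prop.2 a ha b hb hab
  exact hq q (hins (mem_insert _ _)) ⟨q, le_rfl, le_rfl⟩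

/-- The condition `p` decides that the sequence of bits starts with `η`. -/
def DecidesSeq (dec : P → ℕ → Bool → Prop) (p : P) (η : CohenForcing) : Prop :=
  ∀ (i : ℕ) (hi : i < η.len), dec p i (η.entry ⟨i, hi⟩)

/-- The relation `dec p m b`, read as "`p` decides that the `m`-th bit is `b`", describes a Cohen
real: every finite sequence is possible, and each condition has an extension `q` and a finite
sequence `η` such that `q` can be extended so as to decide any prolongation of `η`. -/
structure IsCohenDecision (dec : P → ℕ → Bool → Prop) : Prop where
  mono : ∀ {p q : P} {m : ℕ} {b : Bool}, p ≤ q → dec p m b → dec q m b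
  consistent : ∀ {p : P} {m : ℕ} {b b' : Bool}, dec p m b → dec p m b' → b = b'
  possible : ∀ η, ∃ p, DecidesSeq dec p η
  free : ∀ p, ∃ q, p ≤ q ∧ ∃ η, ∀ ν, η ≤ ν → ∃ r, q ≤ r ∧ DecidesSeq dec r ν

theorem CohenForcing.exists_ge_len (η : CohenForcing) (n : ℕ) :
    ∃ ν : CohenForcing, η ≤ ν ∧ n ≤ ν.len :=
  ⟨⟨max n η.len, fun i => if h : i.1 < η.len then η.entry ⟨i.1, h⟩ else false⟩,
    ⟨le_max_right _ _, fun i hi => by simp [hi]⟩, le_max_left _ _⟩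

namespace IsCohenDecision

variable {dec : P → ℕ → Bool → Prop} (hd : IsCohenDecision dec)
include hd

theorem seq_mono {p q : P} {η ν : CohenForcing} (hpq : p ≤ q) (h : DecidesSeq dec p ν)
    (hη : η ≤ ν) : DecidesSeq dec q η := fun i hi => by
  rw [hη.2 i hi]
  exact hd.mono hpq (h i _)

theorem le_of_len_le {p : P} {η ν : CohenForcing} (hη : DecidesSeq dec p η)
    (hν : DecidesSeq dec p ν) (hlen : η.len ≤ ν.len) : η ≤ ν :=
  ⟨hlen, fun i hi => hd.consistent (hη i hi) (hν i _)⟩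

theorem eq_of_len_eq {p : P} {η ν : CohenForcing} (hη : DecidesSeq dec p η)
    (hν : DecidesSeq dec p ν) (hlen : η.len = ν.len) : η = ν :=
  FinSeq.eq_of_le_of_len_eq (hd.le_of_len_le hη hν hlen.le) hlen

theorem exists_ge_decidesSeq (p : P) (n : ℕ) :
    ∃ q, p ≤ q ∧ ∃ η : CohenForcing, η.len = n ∧ DecidesSeq dec q η := by
  obtain ⟨q, hpq, η, hη⟩ := hd.free p
  obtain ⟨ν, hν, hlen⟩ := CohenForcing.exists_ge_len η n
  obtain ⟨r, hqr, hr⟩ := hη ν hν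
  exact ⟨r, hpq.trans hqr, ν.res n, min_eq_left hlen, fun i hi => hr i _⟩

/-- Under the countable chain condition there is a standard name all of whose conditions decide
the corresponding initial segments. It is read off a refining sequence of maximal antichains. -/
theorem exists_standardName (hccc : IsCCC P) : ∃ τ : StandardName P (fun _ : ℕ => Bool),
    ∀ (η : CohenForcing) (k : ℕ), (k : ℕ∞) < τ.N η → DecidesSeq dec (τ.q η k) η := by
  classical
  let Good (n : ℕ) (A : Set P) : Prop := (∀ p ∈ A, ∀ q ∈ A, p ≠ q → ¬ Compat p q) ∧
    (∀ p, ∃ a ∈ A, Compat p a) ∧ ∀ a ∈ A, ∃ η : CohenForcing, η.len = n ∧ DecidesSeq dec a η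
  have step : ∀ n (A : {A // Good n A}), ∃ B : {B // Good (n + 1) B},
      ∀ b ∈ B.1, ∃ a ∈ A.1, a ≤ b := by
    rintro n ⟨A, hA⟩
    obtain ⟨B, hBD, hB, hB'⟩ := exists_maximal_antichain_subset
      {q : P | (∃ η : CohenForcing, η.len = n + 1 ∧ DecidesSeq dec q η) ∧ ∃ a ∈ A, a ≤ q}
      (fun p => by
        obtain ⟨a, ha, r, hpr, har⟩ := hA.2.1 p
        obtain ⟨q, hrq, hq⟩ := hd.exists_ge_decidesSeq r (n + 1)
        exact ⟨q, ⟨hq, a, ha, har.trans hrq⟩, hpr.trans hrq⟩)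
    exact ⟨⟨B, hB, hB', fun b hb => (hBD hb).1⟩, fun b hb => (hBD hb).2⟩
  obtain ⟨A₀, hA₀⟩ : ∃ A, Good 0 A := by
    obtain ⟨A, hAD, hA, hA'⟩ := exists_maximal_antichain_subset (univ : Set P)
      (fun p => ⟨p, trivial, le_rfl⟩)
    exact ⟨A, hA, hA', fun a _ => ⟨⟨0, Fin.elim0⟩, rfl, fun i hi => absurd hi (Nat.not_lt_zero i)⟩⟩
  choose next hnext using step
  let 𝒜 : ∀ n, {A // Good n A} := fun n => Nat.rec ⟨A₀, hA₀⟩ next n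
  have hsucc : ∀ n, ∀ b ∈ (𝒜 (n + 1)).1, ∃ a ∈ (𝒜 n).1, a ≤ b := fun n => hnext n (𝒜 n)
  have hrefine : ∀ n k, ∀ b ∈ (𝒜 (n + k)).1, ∃ a ∈ (𝒜 n).1, a ≤ b := by
    intro n k
    induction k with
    | zero => exact fun b hb => ⟨b, hb, le_rfl⟩
    | succ k ih =>
      intro b hb
      obtain ⟨c, hc, hcb⟩ := hsucc (n + k) b hb
      obtain ⟨a, ha, hac⟩ := ih c hc
      exact ⟨a, ha, hac.trans hcb⟩
  have : Nonempty P := ⟨(hd.possible ⟨0, Fin.elim0⟩).choose⟩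
  choose N q hq hinj hsurj using fun η : CohenForcing => exists_enumeration
    ((hccc _ (𝒜 η.len).2.1).mono (s₁ := {a | a ∈ (𝒜 η.len).1 ∧ DecidesSeq dec a η})
      fun a ha => ha.1)
  refine ⟨⟨N, q, ?_, ?_, ?_⟩, fun η k hk => (hq η k hk).2⟩
  · intro η ν k m hlen hk hm hne
    have h1 := hq η k hk
    have h2 := hq ν m hm
    have h3 : q ν m ∈ (𝒜 η.len).1 := hlen ▸ h2.1
    refine (𝒜 η.len).2.1 _ h1.1 _ h3 fun heq => hne ?_
    have hην : η = ν := hd.eq_of_len_eq h1.2 (heq ▸ h2.2) hlen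
    subst hην
    rw [hinj η k m hk hm heq]
  · intro n p
    obtain ⟨a, ha, hpa⟩ := (𝒜 n).2.2.1 p
    obtain ⟨η, rfl, hη⟩ := (𝒜 n).2.2.2 a ha
    obtain ⟨k, hk, rfl⟩ := hsurj η a ⟨ha, hη⟩
    exact ⟨η, k, rfl, hk, hpa⟩
  · intro ν η k hlt hk
    obtain ⟨h1, h2⟩ := hq η k hk
    obtain ⟨j, hj⟩ := Nat.exists_eq_add_of_le hlt.le.1
    rw [hj] at h1
    obtain ⟨a, ha, hle⟩ := hrefine _ _ _ h1
    obtain ⟨μ, hμ, hμ'⟩ := (𝒜 ν.len).2.2.2 a ha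
    have hμν : μ = ν := hd.eq_of_len_eq (hd.seq_mono hle hμ' le_rfl)
      (hd.seq_mono le_rfl h2 hlt.le) hμ
    subst hμν
    obtain ⟨m, hm, hm'⟩ := hsurj μ a ⟨ha, hμ'⟩
    exact ⟨m, hm, hm'.trans_le hle⟩

section Copy

variable {τ : StandardName P (fun _ : ℕ => Bool)}
  (hτ : ∀ (η : CohenForcing) (k : ℕ), (k : ℕ∞) < τ.N η → DecidesSeq dec (τ.q η k) η)
include hτ

/-- Every condition has an extension which lies above a condition of the name. -/
theorem exists_ge_name (p : P) (n : ℕ) : ∃ r, p ≤ r ∧ ∃ (η : CohenForcing) (k : ℕ),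
    η.len = n ∧ (k : ℕ∞) < τ.N η ∧ τ.q η k ≤ r ∧ DecidesSeq dec r η := by
  obtain ⟨η, k, hlen, hk, r, hpr, hr⟩ := τ.maximal n p
  exact ⟨r, hpr, η, k, hlen, hk, hr, hd.seq_mono hr (hτ η k hk) le_rfl⟩

theorem forces_of_dec {p : P} {m : ℕ} {b : Bool} (h : dec p m b) :
    τ.Forces p (m + 1) {a | a ⟨m, Nat.lt_succ_self m⟩ = b} := by
  intro q hpq
  obtain ⟨r, hqr, ⟨n, a⟩, k, hlen, hk, hr, hdr⟩ := hd.exists_ge_name hτ q (m + 1)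
  dsimp only at hlen
  subst hlen
  exact ⟨r, hqr, _, ⟨a, hd.consistent (hdr m (Nat.lt_succ_self m)) (hd.mono (hpq.trans hqr) h),
    k, hk, rfl⟩, hr⟩

theorem mem_value_iff (p : P) (η : CohenForcing) :
    p ∈ (τ.value η).1 ↔ ∀ q, p ≤ q → ∃ r, q ≤ r ∧ DecidesSeq dec r η := by
  constructor
  · intro h q hq
    obtain ⟨r, hr, _, ⟨k, hk, rfl⟩, hle⟩ := h q hq
    exact ⟨r, hr, hd.seq_mono hle (hτ η k hk) le_rfl⟩
  · intro h q hq
    obtain ⟨r, hr, hdr⟩ := h q hq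
    obtain ⟨s, hrs, ν, k, hlen, hk, hle, hds⟩ := hd.exists_ge_name hτ r η.len
    have := hd.eq_of_len_eq hds (hd.seq_mono hrs hdr le_rfl) hlen
    subst this
    exact ⟨s, hr.trans hrs, _, ⟨k, hk, rfl⟩, hle⟩

end Copy

end IsCohenDecision

namespace RegOpen

theorem mem_of_le {U : RegOpen P} {p q : P} (hp : p ∈ U.1) (hpq : p ≤ q) : q ∈ U.1 :=
  (U.2 q).2 fun r hr => (U.2 p).1 hp r (hpq.trans hr)

theorem mem_sup_iff {S : Set (RegOpen P)} {p : P} :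
    p ∈ (sup S).1 ↔ ∀ q, p ≤ q → ∃ r, q ≤ r ∧ ∃ U ∈ S, r ∈ U.1 := by
  refine forall₂_congr fun q _ => exists_congr fun r => and_congr_right fun _ => ?_
  constructor
  · rintro ⟨s, hs, hsr⟩
    simp only [mem_iUnion] at hs
    obtain ⟨U, hU, hs⟩ := hs
    exact ⟨U, hU, mem_of_le hs hsr⟩
  · rintro ⟨U, hU, hr⟩
    exact ⟨r, mem_iUnion₂.2 ⟨U, hU, hr⟩, le_rfl⟩

/-- The image in `RO(P)` of a regular open set of the Cohen forcing: the Boolean value of the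
statement that some initial segment of the sequence of bits belongs to the set. -/
def pullback (dec : P → ℕ → Bool → Prop) (U : RegOpen CohenForcing) : RegOpen P :=
  ⟨{p | ∀ q, p ≤ q → ∃ r, q ≤ r ∧ ∃ η ∈ U.1, DecidesSeq dec r η}, fun p => by
    constructor
    · exact fun hp q hq => ⟨q, le_rfl, fun q' hq' => hp q' (hq.trans hq')⟩
    · intro h q hq
      obtain ⟨r, hr, hr'⟩ := h q hq
      obtain ⟨r', h₁, h₂⟩ := hr' r le_rfl
      exact ⟨r', hr.trans h₁, h₂⟩⟩

end RegOpen

namespace IsCohenDecision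

open RegOpen

variable {dec : P → ℕ → Bool → Prop} (hd : IsCohenDecision dec)
include hd

theorem mem_pullback_of_decidesSeq {U : RegOpen CohenForcing} {p : P} {η : CohenForcing}
    (hη : η ∈ U.1) (h : DecidesSeq dec p η) : p ∈ (pullback dec U).1 :=
  fun q hq => ⟨q, le_rfl, η, hη, hd.seq_mono hq h le_rfl⟩

theorem pullback_le_iff {U V : RegOpen CohenForcing} :
    pullback dec U ≤ pullback dec V ↔ U ≤ V := by
  constructor
  · intro h η hη
    refine (V.2 η).2 fun ν hν => ?_
    obtain ⟨p, hp⟩ := hd.possible ν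
    obtain ⟨r, hpr, η', hη', hr⟩ :=
      h (hd.mem_pullback_of_decidesSeq (mem_of_le hη hν) hp) p le_rfl
    have hrν := hd.seq_mono hpr hp le_rfl
    rcases le_total ν.len η'.len with hl | hl
    · exact ⟨η', hd.le_of_len_le hrν hr hl, hη'⟩
    · exact ⟨ν, le_rfl, mem_of_le hη' (hd.le_of_len_le hr hrν hl)⟩
  · intro h p hp q hq
    obtain ⟨r, hr, η, hη, hdr⟩ := hp q hq
    exact ⟨r, hr, η, h hη, hdr⟩

/-- Here the freeness of the sequence of bits is used: the embedding of `RO(2^{<ω})` is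
complete. -/
theorem pullback_compl (U : RegOpen CohenForcing) :
    pullback dec (compl U) = compl (pullback dec U) := by
  refine Subtype.ext (Set.ext fun p => ⟨?_, ?_⟩)
  · intro hp q hq hqU
    obtain ⟨r, hqr, η, hη, hr⟩ := hqU q le_rfl
    obtain ⟨s, hrs, ν, hν, hs⟩ := hp r (hq.trans hqr)
    have hsη := hd.seq_mono hrs hr le_rfl
    rcases le_total η.len ν.len with hl | hl
    · exact hν ν le_rfl (mem_of_le hη (hd.le_of_len_le hsη hs hl))
    · exact hν η (hd.le_of_len_le hs hsη hl) hη
  · intro hp q hq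
    obtain ⟨q', hqq', η, hη⟩ := hd.free q
    obtain ⟨r, hr, hdr⟩ := hη η le_rfl
    refine ⟨r, hqq'.trans hr, η, fun ν hν hνU => ?_, hdr⟩
    obtain ⟨s, hs, hds⟩ := hη ν hν
    exact hp s (hq.trans (hqq'.trans hs)) (hd.mem_pullback_of_decidesSeq hνU hds)

theorem pullback_sup (S : Set (RegOpen CohenForcing)) :
    pullback dec (sup S) = sup (pullback dec '' S) := by
  refine Subtype.ext (Set.ext fun p => ⟨?_, ?_⟩)
  · intro hp
    rw [mem_sup_iff]
    intro q hq
    obtain ⟨r, hqr, η, hη, hr⟩ := hp q hq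
    obtain ⟨r', hrr', η', hη'⟩ := hd.free r
    obtain ⟨s, hs, hds⟩ := hη' η' le_rfl
    have hsη := hd.seq_mono (hrr'.trans hs) hr le_rfl
    -- a common prolongation of `η` and `η'`
    obtain ⟨μ, hημ, hη'μ⟩ : ∃ μ, η ≤ μ ∧ η' ≤ μ := by
      rcases le_total η.len η'.len with hl | hl
      · exact ⟨η', hd.le_of_len_le hsη hds hl, le_rfl⟩
      · exact ⟨η, le_rfl, hd.le_of_len_le hds hsη hl⟩
    obtain ⟨ν, hμν, U, hU, hν⟩ := mem_sup_iff.1 hη μ hημ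
    obtain ⟨t, ht, hdt⟩ := hη' ν (hη'μ.trans hμν)
    exact ⟨t, hqr.trans (hrr'.trans ht), _, mem_image_of_mem _ hU,
      hd.mem_pullback_of_decidesSeq hν hdt⟩
  · intro hp q hq
    obtain ⟨r, hqr, _, ⟨U, hU, rfl⟩, hr⟩ := mem_sup_iff.1 hp q hq
    obtain ⟨s, hrs, η, hη, hs⟩ := hr r le_rfl
    exact ⟨s, hqr.trans hrs, η, mem_sup_iff.2 fun ν hν => ⟨ν, le_rfl, U, hU, mem_of_le hη hν⟩, hs⟩

theorem pullback_cohenName {τ : StandardName P (fun _ : ℕ => Bool)}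
    (hτ : ∀ (η : CohenForcing) (k : ℕ), (k : ℕ∞) < τ.N η → DecidesSeq dec (τ.q η k) η)
    (η : CohenForcing) : pullback dec (cohenName.value η) = τ.value η := by
  refine Subtype.ext (Set.ext fun p => ?_)
  rw [hd.mem_value_iff hτ]
  refine forall₂_congr fun q hq => ⟨?_, ?_⟩
  · rintro ⟨r, hr, ν, hν, hdr⟩
    obtain ⟨s, hrs, μ, hlen, hs⟩ := hd.exists_ge_decidesSeq r (max η.len ν.len)
    have hνμ := hd.le_of_len_le (hd.seq_mono hrs hdr le_rfl) hs (hlen ▸ le_max_right _ _)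
    obtain ⟨μ', hμμ', ρ, ⟨k, -, hρ⟩, hημ'⟩ := hν μ hνμ
    change ρ = η at hρ
    subst hρ
    have hημ : ρ.len ≤ μ.len := hlen ▸ le_max_left _ _
    exact ⟨s, hr.trans hrs, hd.seq_mono le_rfl hs
      ⟨hημ, fun i hi => (hημ'.2 i hi).trans (hμμ'.2 i (hi.trans_le hημ)).symm⟩⟩
  · rintro ⟨r, hr, hdr⟩
    refine ⟨r, hr, η, fun ν hν => ⟨ν, le_rfl, η, ⟨0, ?_, rfl⟩, hν⟩, hdr⟩
    simp [cohenName]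

/-- A name whose conditions decide the corresponding initial segments is a copy of the canonical
name for the Cohen real. -/
theorem isCopyOf_cohenName {τ : StandardName P (fun _ : ℕ => Bool)}
    (hτ : ∀ (η : CohenForcing) (k : ℕ), (k : ℕ∞) < τ.N η → DecidesSeq dec (τ.q η k) η) :
    IsCopyOf cohenName τ := by
  have hval := hd.pullback_cohenName hτ
  have hrange : range (pullback dec) = generated (range τ.value) := by
    refine Subset.antisymm ?_ (sInter_subset_of_mem ⟨⟨?_, ?_⟩, ?_⟩)
    · rintro _ ⟨U, rfl⟩ B ⟨⟨-, hB⟩, hsub⟩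
      have hU : U = sup (cohenName.value '' U.1) := by
        refine Subtype.ext (Set.ext fun η => ?_)
        rw [mem_sup_iff]
        have hself : ∀ ν : CohenForcing, ν ∈ (cohenName.value ν).1 := fun ν μ hμ =>
          ⟨μ, le_rfl, ν, ⟨0, by simp [cohenName], rfl⟩, hμ⟩
        constructor
        · exact fun hη ν hν => ⟨ν, le_rfl, _, mem_image_of_mem _ (mem_of_le hη hν), hself ν⟩
        · intro h
          refine (U.2 η).2 fun ν hν => ?_
          obtain ⟨μ, hμ, _, ⟨ρ, hρ, rfl⟩, hμρ⟩ := h ν hν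
          obtain ⟨μ', hμ', _, ⟨k, -, rfl⟩, hle⟩ := hμρ μ le_rfl
          exact ⟨μ', hμ.trans hμ', mem_of_le hρ hle⟩
      rw [hU, hd.pullback_sup]
      refine hB _ ?_
      rintro _ ⟨_, ⟨η, -, rfl⟩, rfl⟩
      rw [hval]
      exact hsub (mem_range_self η)
    · rintro _ ⟨U, rfl⟩
      exact ⟨compl U, hd.pullback_compl U⟩
    · intro S hS
      refine ⟨sup {U | pullback dec U ∈ S}, ?_⟩
      rw [hd.pullback_sup]
      congr 1
      ext V
      constructor
      · rintro ⟨U, hU, rfl⟩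
        exact hU
      · intro hV
        obtain ⟨U, rfl⟩ := hS hV
        exact ⟨U, hV, rfl⟩
    · rintro _ ⟨η, rfl⟩
      exact ⟨_, hval η⟩
  let e : RegOpen CohenForcing ↪o RegOpen P :=
    OrderEmbedding.ofMapLEIff (pullback dec) fun _ _ => hd.pullback_le_iff
  refine ⟨e.orderIso.trans (OrderIso.setCongr _ _ hrange), fun η => ?_⟩
  rw [← hval]
  rfl

end IsCohenDecision

end CohenNames

/-! ### The bits read off the generic sequence -/

/-- The restriction of an infinite binary sequence to `k`. -/
def initialNode (x : ℕ → Bool) (k : ℕ) : Fin k → Bool := fun i => x i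

/-- The number `m` is the first place at which `x` and `y` differ. -/
def SplitAt (m : ℕ) (x y : ℕ → Bool) : Prop := (∀ i < m, x i = y i) ∧ x m ≠ y m

theorem continuous_initialNode (k : ℕ) : Continuous fun x : ℕ → Bool => initialNode x k :=
  continuous_pi fun _ => continuous_apply _

/-- A form of König's lemma, for pairs of branches which split at `m`. -/
theorem exists_splitAt_of_forall (m : ℕ) (A : ∀ K : ℕ, Set (Fin (K + 1) → Bool))
    (h : ∀ L, ∃ x y, SplitAt m x y ∧ ∀ K ≤ L, initialNode x (K + 1) ∈ A K ∧
      initialNode y (K + 1) ∈ A K) :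
    ∃ x y, SplitAt m x y ∧ ∀ K, initialNode x (K + 1) ∈ A K ∧ initialNode y (K + 1) ∈ A K := by
  let S : ℕ → Set ((ℕ → Bool) × (ℕ → Bool)) := fun L => {z | SplitAt m z.1 z.2 ∧
    ∀ K ≤ L, initialNode z.1 (K + 1) ∈ A K ∧ initialNode z.2 (K + 1) ∈ A K}
  have hclosed : ∀ L, IsClosed (S L) := by
    intro L
    have h1 : IsClosed {z : (ℕ → Bool) × (ℕ → Bool) | SplitAt m z.1 z.2} := by
      have e : {z : (ℕ → Bool) × (ℕ → Bool) | SplitAt m z.1 z.2} =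
          (⋂ i : ℕ, ⋂ _ : i < m, {z : (ℕ → Bool) × (ℕ → Bool) | z.1 i = z.2 i}) ∩
          (fun z : (ℕ → Bool) × (ℕ → Bool) => (z.1 m, z.2 m)) ⁻¹' {b | b.1 ≠ b.2} := by
        ext z
        simp [SplitAt]
      rw [e]
      refine IsClosed.inter (isClosed_iInter fun i => isClosed_iInter fun _ =>
        isClosed_eq (by fun_prop) (by fun_prop)) ?_
      exact (isClosed_discrete _).preimage (by fun_prop)
    have h2 : ∀ K, IsClosed {z : (ℕ → Bool) × (ℕ → Bool) |
        initialNode z.1 (K + 1) ∈ A K ∧ initialNode z.2 (K + 1) ∈ A K} := fun K =>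
      ((isClosed_discrete (A K)).preimage ((continuous_initialNode _).comp continuous_fst)).inter
        ((isClosed_discrete (A K)).preimage ((continuous_initialNode _).comp continuous_snd))
    have e : S L = {z | SplitAt m z.1 z.2} ∩ ⋂ K : ℕ, ⋂ _ : K ≤ L, {z |
        initialNode z.1 (K + 1) ∈ A K ∧ initialNode z.2 (K + 1) ∈ A K} := by
      ext z
      simp [S]
    rw [e]
    exact h1.inter (isClosed_iInter fun K => isClosed_iInter fun _ => h2 K)
  obtain ⟨z, hz⟩ := IsCompact.nonempty_iInter_of_sequence_nonempty_isCompact_isClosed S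
    (fun L z hz => ⟨hz.1, fun K hK => hz.2 K (by omega)⟩)
    (fun L => by
      obtain ⟨x, y, hxy⟩ := h L
      exact ⟨(x, y), hxy⟩)
    (hclosed 0).isCompact hclosed
  rw [mem_iInter] at hz
  exact ⟨z.1, z.2, (hz 0).1, fun K => (hz K).2 K le_rfl⟩

namespace CreatingPair.QStar

variable {H : ℕ → Type*} {D : Type*} {C : CreatingPair H D} {F : Set (ℕ → ℕ)}
variable (g : ∀ k : ℕ, (Fin k → Bool) → ∀ i : ℕ, Set (H i)) (ℓ : ℕ → ℕ)

theorem exists_ge (hC : C.IsComplete) (p : QStar C F) {L : ℕ} (hL : p.len ≤ L)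
    (A : ∀ n, Set (H n)) (hA : ∀ n, (A n).Nonempty) (hsub : ∀ n, A n ⊆ p.poss n)
    (hL' : ∀ n < L, (A n).Subsingleton)
    (hF : ∃ f ∈ F, ∃ a, ∀ n ≥ a, ((f n : ℕ) : ℝ≥0) ≤ C.setNorm n (A n)) :
    ∃ q, p ≤ q ∧ q.len = L ∧ ∀ n, q.poss n = A n := by
  obtain ⟨q, h1, h2⟩ := exists_poss_eq hC L A hA hL' hF
  exact ⟨q, (le_iff hC).2 ⟨h1 ▸ hL, fun n => h2 n ▸ hsub n⟩, h1, h2⟩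

/-- The stem of a condition can be prolonged along any sequence of possibilities. -/
theorem exists_ge_of_branch (hC : C.IsComplete) (p : QStar C F) {L : ℕ} (hL : p.len ≤ L)
    (W : ∀ n, H n) (hW : ∀ n, W n ∈ p.poss n) :
    ∃ q, p ≤ q ∧ q.len = L ∧ (∀ n < L, q.poss n = {W n}) ∧ ∀ n ≥ L, q.poss n = p.poss n := by
  obtain ⟨f, hf, a, ha⟩ := exists_norm_le hC p
  obtain ⟨q, h1, h2, h3⟩ := exists_ge hC p hL (fun n => if n < L then {W n} else p.poss n)
    (fun n => by
      split_ifs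
      · exact singleton_nonempty _
      · exact p.poss_nonempty hC n)
    (fun n => by
      split_ifs
      · exact singleton_subset_iff.2 (hW n)
      · exact subset_rfl)
    (fun n hn => by
      rw [if_pos hn]
      exact subsingleton_singleton)
    ⟨f, hf, max a L, fun n hn => by
      rw [if_neg (not_lt.2 ((le_max_right _ _).trans hn))]
      exact ha n ((le_max_left _ _).trans hn)⟩
  exact ⟨q, h1, h2, fun n hn => by rw [h3, if_pos hn],
    fun n hn => by rw [h3, if_neg (not_lt.2 hn)]⟩

theorem exists_ge_len_eq (hC : C.IsComplete) (p : QStar C F) {L : ℕ} (hL : p.len ≤ L) :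
    ∃ q, p ≤ q ∧ q.len = L ∧ ∀ n ≥ L, q.poss n = p.poss n := by
  choose W hW using p.poss_nonempty hC
  obtain ⟨q, h1, h2, -, h3⟩ := exists_ge_of_branch hC p hL W hW
  exact ⟨q, h1, h2, h3⟩

/-- The condition `p` excludes that the generic sequence hits the node `ρ`, that is, that it takes
a value in `g_ρ(n)` for some `n` in the block `[ℓ K, ℓ (K + 1))` of level `K`. -/
def Avoids (p : QStar C F) (K : ℕ) (ρ : Fin (K + 1) → Bool) : Prop :=
  ∀ n, ℓ K ≤ n → n < ℓ (K + 1) → Disjoint (p.poss n) (g (K + 1) ρ n)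

/-- The condition `p` forces that, on the even levels from `m` on, the generic sequence does not
hit some two branches which split at `m`. -/
def AvoidsSplit (p : QStar C F) (m : ℕ) : Prop :=
  ∃ x y, SplitAt m x y ∧ ∀ K, Even K → m ≤ K →
    Avoids g ℓ p K (initialNode x (K + 1)) ∧ Avoids g ℓ p K (initialNode y (K + 1))

/-- The stem of `p` is so long that it hits, on an even level from `m` on, at least one of any two
branches which split at `m`. -/
def HitsSplit (p : QStar C F) (m : ℕ) : Prop :=
  ∃ L, ℓ (L + 1) ≤ p.len ∧ ¬ ∃ x y, SplitAt m x y ∧ ∀ K ≤ L, Even K → m ≤ K →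
    Avoids g ℓ p K (initialNode x (K + 1)) ∧ Avoids g ℓ p K (initialNode y (K + 1))

/-- The condition `p` decides that the `m`-th bit of the `j`-th real is `b`. If the generic
sequence does not hit some two branches which split at `m`, then this bit is `j`; otherwise it
tells whether some node of the odd level `2m + 1` is hit. -/
def DecidesBit (j : Bool) (p : QStar C F) (m : ℕ) (b : Bool) : Prop :=
  (AvoidsSplit g ℓ p m ∧ b = j) ∨
  (HitsSplit g ℓ p m ∧ ℓ (2 * m + 2) ≤ p.len ∧
    (b = true ↔ ∃ ρ, ¬ Avoids g ℓ p (2 * m + 1) ρ))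

variable {g ℓ}

theorem Avoids.mono (hC : C.IsComplete) {p q : QStar C F} (hpq : p ≤ q) {K : ℕ}
    {ρ : Fin (K + 1) → Bool} (h : Avoids g ℓ p K ρ) : Avoids g ℓ q K ρ :=
  fun n h1 h2 => (h n h1 h2).mono_left (((le_iff hC).1 hpq).2 n)

/-- What happens below the length of the stem is already decided. -/
theorem avoids_iff_of_le (hC : C.IsComplete) {p q : QStar C F} (hpq : p ≤ q) {K : ℕ}
    (hK : ℓ (K + 1) ≤ p.len) (ρ : Fin (K + 1) → Bool) :
    Avoids g ℓ q K ρ ↔ Avoids g ℓ p K ρ := by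
  refine forall_congr' fun n => forall₂_congr fun _ h2 => ?_
  rw [poss_eq_of_le hC hpq (h2.trans_le hK)]

theorem AvoidsSplit.mono (hC : C.IsComplete) {p q : QStar C F} (hpq : p ≤ q) {m : ℕ}
    (h : AvoidsSplit g ℓ p m) : AvoidsSplit g ℓ q m := by
  obtain ⟨x, y, hxy, h⟩ := h
  exact ⟨x, y, hxy, fun K hK hm => ⟨(h K hK hm).1.mono hC hpq, (h K hK hm).2.mono hC hpq⟩⟩

theorem HitsSplit.mono (hC : C.IsComplete) (hℓ : StrictMono ℓ) {p q : QStar C F} (hpq : p ≤ q)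
    {m : ℕ} (h : HitsSplit g ℓ p m) : HitsSplit g ℓ q m := by
  obtain ⟨L, hL, h⟩ := h
  refine ⟨L, hL.trans ((le_iff hC).1 hpq).1, fun ⟨x, y, hxy, h'⟩ => h ⟨x, y, hxy, ?_⟩⟩
  intro K hKL hK hm
  have hlen : ℓ (K + 1) ≤ p.len := (hℓ.monotone (by omega)).trans hL
  rw [← avoids_iff_of_le hC hpq hlen, ← avoids_iff_of_le hC hpq hlen]
  exact h' K hKL hK hm

theorem AvoidsSplit.not_hitsSplit {p : QStar C F} {m : ℕ} (h : AvoidsSplit g ℓ p m) :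
    ¬ HitsSplit g ℓ p m := by
  rintro ⟨L, -, h'⟩
  obtain ⟨x, y, hxy, h⟩ := h
  exact h' ⟨x, y, hxy, fun K _ => h K⟩

theorem DecidesBit.mono (hC : C.IsComplete) (hℓ : StrictMono ℓ) {j : Bool} {p q : QStar C F}
    (hpq : p ≤ q) {m : ℕ} {b : Bool} (h : DecidesBit g ℓ j p m b) : DecidesBit g ℓ j q m b := by
  rcases h with ⟨h, rfl⟩ | ⟨h1, h2, h3⟩
  · exact Or.inl ⟨h.mono hC hpq, rfl⟩
  · refine Or.inr ⟨h1.mono hC hℓ hpq, h2.trans ((le_iff hC).1 hpq).1, ?_⟩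
    simp only [avoids_iff_of_le hC hpq h2]
    exact h3

theorem DecidesBit.consistent {j : Bool} {p : QStar C F} {m : ℕ} {b b' : Bool}
    (h : DecidesBit g ℓ j p m b) (h' : DecidesBit g ℓ j p m b') : b = b' := by
  rcases h with ⟨h, rfl⟩ | ⟨h1, -, h2⟩ <;> rcases h' with ⟨h', rfl⟩ | ⟨h1', -, h2'⟩
  · rfl
  · exact absurd h1' h.not_hitsSplit
  · exact absurd h1 h'.not_hitsSplit
  · exact Bool.eq_iff_iff.2 (h2.trans h2'.symm)

/-! ### Free extensions of normal conditions -/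

/-- A condition which is normal from level `k₀` on: on these levels each node is either avoided
or can be hit in many places, no level is avoided altogether, and it is always possible to hit no
node. -/
structure IsNormal (g : ∀ k : ℕ, (Fin k → Bool) → ∀ i : ℕ, Set (H i)) (ℓ : ℕ → ℕ)
    (p : QStar C F) (k₀ : ℕ) : Prop where
  len_eq : p.len = ℓ k₀
  room : ∀ K ≥ k₀, ∀ n, ℓ K ≤ n → n < ℓ (K + 1) → (p.poss n \ ⋃ ρ, g (K + 1) ρ n).Nonempty
  many : ∀ K ≥ k₀, ∀ ρ, ¬ Avoids g ℓ p K ρ → 2 ^ (K + 1) ≤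
    {n : ℕ | ℓ K ≤ n ∧ n < ℓ (K + 1) ∧ (g (K + 1) ρ n ∩ p.poss n).Nonempty}.ncard
  hittable : ∀ K ≥ k₀, ∃ ρ, ¬ Avoids g ℓ p K ρ

/-- All nodes of a given level which are not avoided can be hit simultaneously, because the
number of places at which each of them can be hit is at least the number of these nodes. -/
theorem IsNormal.exists_block_hit (hC : C.IsComplete) {p : QStar C F} {k₀ : ℕ}
    (hp : IsNormal g ℓ p k₀) {K : ℕ} (hK : k₀ ≤ K) :
    ∃ V : ∀ n, H n, (∀ n, V n ∈ p.poss n) ∧ ∀ ρ, ¬ Avoids g ℓ p K ρ →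
      ∃ n, ℓ K ≤ n ∧ n < ℓ (K + 1) ∧ V n ∈ g (K + 1) ρ n := by
  classical
  let ι := {ρ : Fin (K + 1) → Bool // ¬ Avoids g ℓ p K ρ}
  let T : ι → Finset ℕ := fun ρ => (Finset.Ico (ℓ K) (ℓ (K + 1))).filter fun n =>
    (g (K + 1) ρ.1 n ∩ p.poss n).Nonempty
  have hT : ∀ ρ : ι, Fintype.card ι ≤ (T ρ).card := by
    intro ρ
    have h1 := hp.many K hK ρ.1 ρ.2
    have e : {n : ℕ | ℓ K ≤ n ∧ n < ℓ (K + 1) ∧ (g (K + 1) ρ.1 n ∩ p.poss n).Nonempty} = T ρ := by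
      ext n
      simp [T, and_assoc]
    rw [e, ncard_coe_finset] at h1
    refine le_trans ?_ h1
    exact (Fintype.card_subtype_le _).trans (by simp)
  obtain ⟨e, he, heT⟩ := (Finset.all_card_le_biUnion_card_iff_exists_injective T).1 (by
    intro s
    rcases s.eq_empty_or_nonempty with rfl | ⟨ρ, hρ⟩
    · simp
    · exact (Finset.card_le_univ s).trans ((hT ρ).trans
        (Finset.card_le_card (Finset.subset_biUnion_of_mem T hρ))))
  have heT' : ∀ ρ : ι, ∃ a, a ∈ g (K + 1) ρ.1 (e ρ) ∩ p.poss (e ρ) := fun ρ =>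
    (Finset.mem_filter.1 (heT ρ)).2
  have key : ∀ n, ∃ v ∈ p.poss n, ∀ ρ : ι, e ρ = n → v ∈ g (K + 1) ρ.1 n := by
    intro n
    by_cases h : ∃ ρ, e ρ = n
    · obtain ⟨ρ, rfl⟩ := h
      obtain ⟨a, ha, ha'⟩ := heT' ρ
      refine ⟨a, ha', fun ρ' hρ' => ?_⟩
      rw [he hρ']
      exact ha
    · obtain ⟨a, ha⟩ := p.poss_nonempty hC n
      exact ⟨a, ha, fun ρ hρ => absurd ⟨ρ, hρ⟩ h⟩
  choose V hV hV' using key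
  refine ⟨V, hV, fun ρ hρ => ⟨e ⟨ρ, hρ⟩, ?_⟩⟩
  have := Finset.mem_Ico.1 (Finset.mem_filter.1 (heT ⟨ρ, hρ⟩)).1
  exact ⟨this.1, this.2, hV' _ ⟨ρ, hρ⟩ rfl⟩

/-- On each level one may choose between hitting all nodes which are not avoided and hitting
none. -/
theorem IsNormal.exists_branch (hC : C.IsComplete) (hℓ : StrictMono ℓ) {p : QStar C F} {k₀ : ℕ}
    (hp : IsNormal g ℓ p k₀) (d : ℕ → Bool) :
    ∃ W : ∀ n, H n, (∀ n, W n ∈ p.poss n) ∧ ∀ K ≥ k₀,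
      (d K = true → ∀ ρ, ¬ Avoids g ℓ p K ρ → ∃ n, ℓ K ≤ n ∧ n < ℓ (K + 1) ∧
        W n ∈ g (K + 1) ρ n) ∧
      (d K = false → ∀ ρ n, ℓ K ≤ n → n < ℓ (K + 1) → W n ∉ g (K + 1) ρ n) := by
  classical
  have key : ∀ K, ∃ V : ∀ n, H n, (∀ n, V n ∈ p.poss n) ∧ (k₀ ≤ K →
      (d K = true → ∀ ρ, ¬ Avoids g ℓ p K ρ → ∃ n, ℓ K ≤ n ∧ n < ℓ (K + 1) ∧
        V n ∈ g (K + 1) ρ n) ∧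
      (d K = false → ∀ ρ n, ℓ K ≤ n → n < ℓ (K + 1) → V n ∉ g (K + 1) ρ n)) := by
    intro K
    choose V₀ hV₀ using p.poss_nonempty hC
    by_cases hK : k₀ ≤ K
    · cases hd : d K with
      | true =>
        obtain ⟨V, hV, hV'⟩ := hp.exists_block_hit hC hK
        exact ⟨V, hV, fun _ => ⟨fun _ => hV', by simp⟩⟩
      | false =>
        have : ∀ n, ∃ v ∈ p.poss n, ℓ K ≤ n → n < ℓ (K + 1) → ∀ ρ, v ∉ g (K + 1) ρ n := by
          intro n
          by_cases hn : ℓ K ≤ n ∧ n < ℓ (K + 1)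
          · obtain ⟨v, hv, hv'⟩ := hp.room K hK n hn.1 hn.2
            exact ⟨v, hv, fun _ _ ρ hρ => hv' (mem_iUnion.2 ⟨ρ, hρ⟩)⟩
          · exact ⟨V₀ n, hV₀ n, fun h1 h2 => absurd ⟨h1, h2⟩ hn⟩
        choose V hV hV' using this
        exact ⟨V, hV, fun _ => ⟨by simp, fun _ ρ n h1 h2 => hV' n h1 h2 ρ⟩⟩
    · exact ⟨V₀, hV₀, fun h => absurd h hK⟩
  choose V hV hV' using key
  -- the level of a place
  have hlevel : ∀ n, ∃ K, ∀ K', ℓ K' ≤ n → n < ℓ (K' + 1) → K' = K := by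
    intro n
    by_cases h : ∃ K, ℓ K ≤ n ∧ n < ℓ (K + 1)
    · obtain ⟨K, h1, h2⟩ := h
      refine ⟨K, fun K' h3 h4 => ?_⟩
      have := hℓ.lt_iff_lt.1 (h1.trans_lt h4)
      have := hℓ.lt_iff_lt.1 (h3.trans_lt h2)
      omega
    · exact ⟨0, fun K' h1 h2 => absurd ⟨K', h1, h2⟩ h⟩
  choose lev hlev using hlevel
  refine ⟨fun n => V (lev n) n, fun n => hV _ n, fun K hK => ⟨fun hd ρ hρ => ?_,
    fun hd ρ n h1 h2 => ?_⟩⟩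
  · obtain ⟨n, h1, h2, h3⟩ := (hV' K hK).1 hd ρ hρ
    exact ⟨n, h1, h2, by dsimp only; rw [← hlev n K h1 h2]; exact h3⟩
  · dsimp only
    rw [← hlev n K h1 h2]
    exact (hV' K hK).2 hd ρ n h1 h2

/-- A normal condition can be extended so as to decide arbitrarily the bits which it has neither
set by avoiding two branches nor read off its stem. -/
theorem IsNormal.exists_decidesBit (hC : C.IsComplete) (hℓ : StrictMono ℓ) {p : QStar C F}
    {k₀ : ℕ} (hp : IsNormal g ℓ p k₀) (j : Bool) (s : ℕ → Bool) (M : ℕ)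
    (hs : ∀ m < M, AvoidsSplit g ℓ p m → s m = j)
    (hs' : ∀ m < M, ¬ AvoidsSplit g ℓ p m → 2 * m + 1 < k₀ →
      (s m = true ↔ ∃ ρ, ¬ Avoids g ℓ p (2 * m + 1) ρ)) :
    ∃ q, p ≤ q ∧ ∀ m < M, DecidesBit g ℓ j q m (s m) := by
  classical
  -- hit everything on the even levels, and code `s` on the odd levels
  obtain ⟨W, hW, hW'⟩ := hp.exists_branch hC hℓ fun K => if Even K then true else s (K / 2)
  have hL : ∀ m, ∃ L, ¬ AvoidsSplit g ℓ p m → ¬ ∃ x y, SplitAt m x y ∧ ∀ K ≤ L, Even K → m ≤ K →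
      Avoids g ℓ p K (initialNode x (K + 1)) ∧ Avoids g ℓ p K (initialNode y (K + 1)) := by
    intro m
    by_contra! hcon
    have h1 := (hcon 0).1
    obtain ⟨x, y, hxy, h2⟩ := exists_splitAt_of_forall m
      (fun K => {ρ | Even K → m ≤ K → Avoids g ℓ p K ρ}) (fun L => by
        obtain ⟨-, x, y, hxy, h⟩ := hcon L
        exact ⟨x, y, hxy, fun K hK => ⟨fun h1 h2 => (h K hK h1 h2).1,
          fun h1 h2 => (h K hK h1 h2).2⟩⟩)
    exact h1 ⟨x, y, hxy, fun K hK hm => ⟨(h2 K).1 hK hm, (h2 K).2 hK hm⟩⟩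
  choose L hL using hL
  obtain ⟨N, hN1, hN2, hN3⟩ : ∃ N, k₀ ≤ N ∧ 2 * M ≤ N ∧ ∀ m < M, L m ≤ N := by
    refine ⟨max k₀ (2 * M) + (Finset.range M).sup L, by omega, by omega, fun m hm => ?_⟩
    have := Finset.le_sup (f := L) (Finset.mem_range.2 hm)
    omega
  have hlenN : p.len ≤ ℓ (N + 1) := hp.len_eq.trans_le (hℓ.monotone (by omega))
  obtain ⟨q, hpq, hq1, hq2, hq3⟩ := exists_ge_of_branch hC p hlenN W hW
  refine ⟨q, hpq, fun m hm => ?_⟩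
  by_cases hsplit : AvoidsSplit g ℓ p m
  · exact Or.inl ⟨hsplit.mono hC hpq, hs m hm hsplit⟩
  have hstem : ∀ K < k₀, ∀ ρ, Avoids g ℓ q K ρ ↔ Avoids g ℓ p K ρ := fun K hK =>
    avoids_iff_of_le hC hpq (hp.len_eq ▸ hℓ.monotone hK)
  have hposs : ∀ K ≤ N, ∀ n < ℓ (K + 1), q.poss n = {W n} := fun K hK n hn =>
    hq2 n (hn.trans_le (hℓ.monotone (by omega)))
  refine Or.inr ⟨⟨N, hq1.ge, fun ⟨x, y, hxy, h⟩ => hL m hsplit ⟨x, y, hxy, ?_⟩⟩,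
    hq1 ▸ hℓ.monotone (by omega), ?_⟩
  · have havoid : ∀ K ≤ N, Even K → ∀ ρ, Avoids g ℓ q K ρ → Avoids g ℓ p K ρ := by
      intro K hKN hK ρ hρ
      rcases lt_or_ge K k₀ with hlt | hge
      · exact (hstem K hlt ρ).1 hρ
      · by_contra hcon
        obtain ⟨n, h1, h2, h3⟩ := (hW' K hge).1 (if_pos hK) ρ hcon
        have := hρ n h1 h2
        rw [hposs K hKN n h2] at this
        exact disjoint_singleton_left.1 this h3
    intro K hK hev hmK
    have hKN : K ≤ N := hK.trans (hN3 m hm)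
    exact ⟨havoid K hKN hev _ (h K hKN hev hmK).1, havoid K hKN hev _ (h K hKN hev hmK).2⟩
  · rcases lt_or_ge (2 * m + 1) k₀ with hlt | hge
    · simp only [hstem _ hlt]
      exact hs' m hm hsplit hlt
    · have hodd : ¬ Even (2 * m + 1) := by simp
      have hdiv : (2 * m + 1) / 2 = m := by omega
      have hW'' := hW' (2 * m + 1) hge
      rw [if_neg hodd, hdiv] at hW''
      have hle : 2 * m + 1 ≤ N := by omega
      constructor
      · intro hsm
        obtain ⟨ρ, hρ⟩ := hp.hittable _ hge
        refine ⟨ρ, fun hav => ?_⟩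
        obtain ⟨n, h1, h2, h3⟩ := hW''.1 hsm ρ hρ
        have := hav n h1 h2
        rw [hposs _ hle n h2] at this
        exact disjoint_singleton_left.1 this h3
      · rintro ⟨ρ, hρ⟩
        by_contra hsm
        refine hρ fun n h1 h2 => ?_
        rw [hposs _ hle n h2]
        exact disjoint_singleton_left.2 (hW''.2 (by simpa using hsm) ρ n h1 h2)

end CreatingPair.QStar

/-! ### Normal conditions are dense -/

theorem exists_level {ℓ : ℕ → ℕ} (hℓ : StrictMono ℓ) {k₀ n : ℕ} (hn : ℓ k₀ ≤ n) :
    ∃ K ≥ k₀, ℓ K ≤ n ∧ n < ℓ (K + 1) := by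
  have hex : ∃ k, n < ℓ (k + 1) := ⟨n, (Nat.lt_succ_self n).trans_le hℓ.le_apply⟩
  classical
  refine ⟨Nat.find hex, ?_, ?_, Nat.find_spec hex⟩
  · by_contra hlt
    have := hℓ.monotone (show Nat.find hex + 1 ≤ k₀ by omega)
    exact absurd (Nat.find_spec hex) (by omega)
  · rcases Nat.eq_zero_or_pos (Nat.find hex) with h0 | hpos
    · rw [h0]
      exact (hℓ.monotone (Nat.zero_le _)).trans hn
    · have := Nat.find_min hex (show Nat.find hex - 1 < Nat.find hex by omega)
      rw [show Nat.find hex - 1 + 1 = Nat.find hex by omega] at this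
      omega

theorem level_unique {ℓ : ℕ → ℕ} (hℓ : StrictMono ℓ) {K K' n : ℕ} (h1 : ℓ K ≤ n)
    (h2 : n < ℓ (K + 1)) (h3 : ℓ K' ≤ n) (h4 : n < ℓ (K' + 1)) : K' = K := by
  have := hℓ.lt_iff_lt.1 (h1.trans_lt h4)
  have := hℓ.lt_iff_lt.1 (h3.trans_lt h2)
  omega

theorem IsRegressive.mono {h : ℕ → ℕ → ℕ} (hh : IsRegressive h) (m : ℕ) : Monotone (h m) := by
  intro k l hkl
  rcases hkl.eq_or_lt with rfl | hlt
  · exact le_rfl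
  · exact (hh m).2 k l hlt

namespace CreatingPair.QStar

variable {H : ℕ → Type*} {D : Type*} {C : CreatingPair H D} {F : Set (ℕ → ℕ)}
variable {g : ∀ k : ℕ, (Fin k → Bool) → ∀ i : ℕ, Set (H i)} {ℓ : ℕ → ℕ} {h : ℕ → ℕ → ℕ}

/-- The two requirements on pure candidates in a sourness system, for the sets of possibilities of a
condition whose stem ends where a block begins. -/
theorem exists_bound_missing (hC : C.IsComplete) (hb : IsSournessSystem C F g ℓ) (p : QStar C F)
    {k₀ : ℕ} (hlen : p.len = ℓ k₀) {f : ℕ → ℕ} (hf : f ∈ F)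
    (hp : ∀ n ≥ ℓ k₀, ((f n : ℕ) : ℝ≥0) ≤ C.setNorm n (p.poss n)) :
    (∃ N : ℕ, ∀ K ≥ k₀, {ρ : Fin (K + 1) → Bool | {n : ℕ | ℓ K ≤ n ∧ n < ℓ (K + 1) ∧
      (g (K + 1) ρ n ∩ p.poss n).Nonempty}.ncard < 2 ^ (K + 1)}.ncard ≤ N) ∧
    ∃ k₁ ≥ k₀, ∀ K ≥ k₁, ∀ n, ℓ K ≤ n → n < ℓ (K + 1) →
      (p.poss n \ ⋃ ρ, g (K + 1) ρ n).Nonempty := by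
  have hcand : C.IsPureCandidate p.1.t :=
    ⟨p.1.mem, p.1.consecutive, p.1.w, p.1.w_mem, p.1.pos_sub⟩
  have hlen' : p.1.w.len = ℓ k₀ := hlen
  have hmdn : (p.1.t 0).mdn = ℓ k₀ := by rw [Condition.mdn_eq hC, hlen', add_zero]
  have hnor : ∀ n, ((f (n + ℓ k₀) : ℕ) : ℝ≥0) ≤ (p.1.t n).nor := by
    intro n
    have := hp (n + ℓ k₀) (by omega)
    rwa [add_comm, ← hlen', poss, setNorm_eq hC (p.1.isAt_poss hC n), hlen', add_comm] at this
  have hposs : ∀ K ≥ k₀, ∀ n, ℓ K ≤ n → (p.1.t (n - ℓ k₀)).pos n = p.poss n := by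
    intro K hK n hn
    have := hb.increasing.monotone hK
    rw [← hlen', poss, Condition.poss_of_le _ (by omega)]
  constructor
  · obtain ⟨N, hN⟩ := hb.few_missing f hf p.1.t k₀ hcand hmdn hnor
    refine ⟨N, fun K hK => le_trans (le_of_eq ?_) (hN K hK)⟩
    congr 1
    ext ρ
    simp only [mem_ofPred_eq]
    suffices e : {n : ℕ | ℓ K ≤ n ∧ n < ℓ (K + 1) ∧ (g (K + 1) ρ n ∩ p.poss n).Nonempty} =
        {n : ℕ | ℓ K ≤ n ∧ n < ℓ (K + 1) ∧
          (g (K + 1) ρ n ∩ (p.1.t (n - ℓ k₀)).pos n).Nonempty} by rw [e]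
    ext n
    refine and_congr_right fun h1 => ?_
    rw [hposs K hK n h1]
  · obtain ⟨k₁, hk₁, h⟩ := hb.not_covered f hf p.1.t k₀ hcand hmdn hnor
    refine ⟨k₁, hk₁, fun K hK n h1 h2 => ?_⟩
    rw [← hposs K (hk₁.trans hK) n h1]
    exact h K hK n h1 h2

/-- The assumption that removing the values for one node from a set of possibilities lowers its
norm by at most one application of `h`. -/
def RemovalBound (C : CreatingPair H D) (h : ℕ → ℕ → ℕ)
    (g : ∀ k : ℕ, (Fin k → Bool) → ∀ i : ℕ, Set (H i)) (ℓ : ℕ → ℕ) : Prop :=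
  ∀ (k n : ℕ) (A : Set (H n)) (ρ : Fin (k + 1) → Bool), ℓ k ≤ n → n < ℓ (k + 1) →
    (A \ g (k + 1) ρ n).Nonempty →
      ((h n ⌊C.setNorm n A⌋₊ : ℕ) : ℝ≥0) ≤ C.setNorm n (A \ g (k + 1) ρ n)

/-- Removing boundedly many nodes on each level from the sets of possibilities does not destroy
the condition on the norms, since the family is `h`-closed. -/
theorem exists_norm_le_diff (hh : IsRegressive h) (hF : ∀ f ∈ F, ∀ n, 2 ≤ f n)
    (hFh : IsClosedUnderRegression h F) (hc : RemovalBound C h g ℓ)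
    (A : ∀ n, Set (H n)) {k₀ : ℕ} (hroom : ∀ K ≥ k₀, ∀ n, ℓ K ≤ n → n < ℓ (K + 1) →
      (A n \ ⋃ ρ, g (K + 1) ρ n).Nonempty) {f : ℕ → ℕ} (hf : f ∈ F) {a : ℕ}
    (hA : ∀ n ≥ a, ((f n : ℕ) : ℝ≥0) ≤ C.setNorm n (A n)) (N : ℕ) :
    ∃ f' ∈ F, ∃ a', ∀ n ≥ a', ∀ K ≥ k₀, ℓ K ≤ n → n < ℓ (K + 1) →
      ∀ R : Finset (Fin (K + 1) → Bool), R.card ≤ N →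
        ((f' n : ℕ) : ℝ≥0) ≤ C.setNorm n (A n \ ⋃ ρ ∈ R, g (K + 1) ρ n) := by
  classical
  induction N with
  | zero =>
    refine ⟨f, hf, a, fun n hn K _ _ _ R hR => ?_⟩
    obtain rfl : R = ∅ := by simpa using hR
    simpa using hA n hn
  | succ N ih =>
    obtain ⟨f₁, hf₁, a₁, h₁⟩ := ih
    obtain ⟨f₂, hf₂, h₂⟩ := hFh f₁ hf₁
    obtain ⟨a₂, h₂⟩ := eventually_atTop.1 h₂
    refine ⟨f₂, hf₂, max a₁ a₂, fun n hn K hK hK1 hK2 R hR => ?_⟩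
    have hle := h₂ n ((le_max_right _ _).trans hn)
    have hle₁ := h₁ n ((le_max_left _ _).trans hn) K hK hK1 hK2
    rcases R.eq_empty_or_nonempty with rfl | ⟨ρ, hρ⟩
    · refine le_trans ?_ (hle₁ ∅ (by simp))
      exact_mod_cast hle.trans (((hh n).1 _ (hF f₁ hf₁ n)).2.le)
    · have e : A n \ ⋃ ρ' ∈ R, g (K + 1) ρ' n =
          (A n \ ⋃ ρ' ∈ R.erase ρ, g (K + 1) ρ' n) \ g (K + 1) ρ n := by
        rw [sdiff_sdiff, ← Finset.insert_erase hρ, Finset.set_biUnion_insert, union_comm,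
          Finset.erase_insert (Finset.notMem_erase ρ R)]
      have hne : (A n \ ⋃ ρ' ∈ R, g (K + 1) ρ' n).Nonempty :=
        (hroom K hK n hK1 hK2).mono (sdiff_subset_sdiff_right
          (iUnion₂_subset fun ρ' _ => subset_iUnion (fun ρ' => g (K + 1) ρ' n) ρ'))
      rw [e] at hne ⊢
      refine le_trans ?_ (hc K n _ ρ hK1 hK2 hne)
      have h3 : f₁ n ≤ ⌊C.setNorm n (A n \ ⋃ ρ' ∈ R.erase ρ, g (K + 1) ρ' n)⌋₊ :=
        Nat.le_floor (hle₁ _ (by rw [Finset.card_erase_of_mem hρ]; omega))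
      exact_mod_cast hle.trans (hh.mono n h3)

/-- Normal conditions, with a bound on the number of avoided nodes on each level, are dense: it is
possible to avoid all those nodes which can be hit in few places only. -/
theorem exists_ge_isNormal (hh : IsRegressive h) (hF : ∀ f ∈ F, ∀ n, 2 ≤ f n)
    (hFh : IsClosedUnderRegression h F) (hC : C.IsComplete) (hb : IsSournessSystem C F g ℓ)
    (hc : RemovalBound C h g ℓ) (p : QStar C F) :
    ∃ q, p ≤ q ∧ ∃ k₀ N : ℕ, IsNormal g ℓ q k₀ ∧
      ∀ K ≥ k₀, {ρ | Avoids g ℓ q K ρ}.ncard ≤ N := by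
  classical
  have hℓ := hb.increasing
  obtain ⟨f, hf, a, ha⟩ := exists_norm_le hC p
  obtain ⟨p₁, hpp₁, hp₁, hp₁'⟩ := exists_ge_len_eq hC p (L := ℓ (max p.len a))
    ((le_max_left _ _).trans hℓ.le_apply)
  have hnorm : ∀ n ≥ ℓ (max p.len a), ((f n : ℕ) : ℝ≥0) ≤ C.setNorm n (p₁.poss n) :=
    fun n hn => by
      rw [hp₁' n hn]
      exact ha n (((le_max_right _ _).trans hℓ.le_apply).trans hn)
  obtain ⟨⟨N, hN⟩, k₁, hk₁, hroom⟩ := exists_bound_missing hC hb p₁ hp₁ hf hnorm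
  obtain ⟨k₂, hk₂, hNk₂⟩ : ∃ k₂, k₁ ≤ k₂ ∧ N < 2 ^ k₂ :=
    ⟨max k₁ N, le_max_left _ _, (Nat.lt_two_pow_self).trans_le
      (Nat.pow_le_pow_right (by norm_num) (le_max_right _ _))⟩
  obtain ⟨p₂, hp₁p₂, hp₂, hp₂'⟩ := exists_ge_len_eq hC p₁ (L := ℓ k₂)
    (hp₁ ▸ hℓ.monotone (hk₁.trans hk₂))
  -- the nodes which can be hit in few places only
  let E : ∀ K : ℕ, Finset (Fin (K + 1) → Bool) := fun K => Finset.univ.filter fun ρ =>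
    {n : ℕ | ℓ K ≤ n ∧ n < ℓ (K + 1) ∧ (g (K + 1) ρ n ∩ p₁.poss n).Nonempty}.ncard < 2 ^ (K + 1)
  have hE : ∀ K ≥ k₂, (E K).card ≤ N := fun K hK => by
    have := hN K (hk₁.trans (hk₂.trans hK))
    rwa [← ncard_coe_finset, Finset.coe_filter_univ]
  let A : ∀ n, Set (H n) := fun n => {v ∈ p₂.poss n | ℓ k₂ ≤ n → ∀ K, ℓ K ≤ n → n < ℓ (K + 1) →
    ∀ ρ ∈ E K, v ∉ g (K + 1) ρ n}
  have hA : ∀ K ≥ k₂, ∀ n, ℓ K ≤ n → n < ℓ (K + 1) →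
      A n = p₁.poss n \ ⋃ ρ ∈ E K, g (K + 1) ρ n := by
    intro K hK n h1 h2
    have hk₂n : ℓ k₂ ≤ n := (hℓ.monotone hK).trans h1
    ext v
    simp only [A, mem_ofPred_eq, hp₂' n hk₂n, Set.mem_sdiff, mem_iUnion, not_exists]
    refine and_congr_right fun _ => ⟨fun hv => hv hk₂n K h1 h2, fun hv _ K' h3 h4 => ?_⟩
    obtain rfl := level_unique hℓ h1 h2 h3 h4
    exact hv
  have hroom' : ∀ K ≥ k₂, ∀ n, ℓ K ≤ n → n < ℓ (K + 1) →
      (A n \ ⋃ ρ, g (K + 1) ρ n).Nonempty := by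
    intro K hK n h1 h2
    obtain ⟨v, hv, hv'⟩ := hroom K (hk₂.trans hK) n h1 h2
    rw [hA K hK n h1 h2]
    refine ⟨v, ⟨hv, fun hv'' => hv' ?_⟩, hv'⟩
    simp only [mem_iUnion] at hv'' ⊢
    obtain ⟨ρ, -, hρ⟩ := hv''
    exact ⟨ρ, hρ⟩
  have hlow : ∀ n < ℓ k₂, A n = p₂.poss n := by
    intro n hn
    ext v
    simp only [A, mem_ofPred_eq, and_iff_left_iff_imp]
    exact fun _ hn' => absurd hn (by omega)
  obtain ⟨f', hf', a', ha'⟩ := exists_norm_le_diff hh hF hFh hc p₁.poss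
    (fun K hK => hroom K (hk₂.trans hK)) hf hnorm N
  obtain ⟨q, hp₂q, hq, hq'⟩ := exists_ge hC p₂ hp₂.le A
    (fun n => by
      rcases lt_or_ge n (ℓ k₂) with hn | hn
      · rw [hlow n hn]
        exact p₂.poss_nonempty hC n
      · obtain ⟨K, hK, h1, h2⟩ := exists_level hℓ hn
        exact (hroom' K hK n h1 h2).mono sdiff_subset)
    (fun n => sep_subset _ _)
    (fun n hn => (p₂.poss_subsingleton (hp₂ ▸ hn)).anti (sep_subset _ _))
    ⟨f', hf', max a' (ℓ k₂), fun n hn => by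
      obtain ⟨K, hK, h1, h2⟩ := exists_level hℓ ((le_max_right _ _).trans hn)
      rw [hA K hK n h1 h2]
      exact ha' n ((le_max_left _ _).trans hn) K hK h1 h2 (E K) (hE K hK)⟩
  have havoid : ∀ K ≥ k₂, ∀ ρ ∈ E K, Avoids g ℓ q K ρ := by
    intro K hK ρ hρ n h1 h2
    rw [hq', hA K hK n h1 h2, disjoint_left]
    rintro v ⟨-, hv⟩ hv'
    exact hv (mem_iUnion₂.2 ⟨ρ, hρ, hv'⟩)
  have hmany : ∀ K ≥ k₂, ∀ ρ ∉ E K, 2 ^ (K + 1) ≤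
      {n : ℕ | ℓ K ≤ n ∧ n < ℓ (K + 1) ∧ (g (K + 1) ρ n ∩ q.poss n).Nonempty}.ncard := by
    intro K hK ρ hρ
    have e : {n : ℕ | ℓ K ≤ n ∧ n < ℓ (K + 1) ∧ (g (K + 1) ρ n ∩ q.poss n).Nonempty} =
        {n : ℕ | ℓ K ≤ n ∧ n < ℓ (K + 1) ∧ (g (K + 1) ρ n ∩ p₁.poss n).Nonempty} := by
      ext n
      refine and_congr_right fun h1 => and_congr_right fun h2 => ?_
      rw [hq', hA K hK n h1 h2]
      constructor
      · rintro ⟨v, hv, hv', -⟩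
        exact ⟨v, hv, hv'⟩
      · rintro ⟨v, hv, hv'⟩
        refine ⟨v, hv, hv', fun hv'' => ?_⟩
        obtain ⟨ρ', hρ', hv''⟩ := mem_iUnion₂.1 hv''
        have hne : ρ ≠ ρ' := fun heq => hρ (heq ▸ hρ')
        exact disjoint_left.1 (hb.disjoint K n h1 h2 ρ ρ' hne) hv hv''
    rw [e]
    simpa [E] using hρ
  have hnot : ∀ K ≥ k₂, ∀ ρ ∉ E K, ¬ Avoids g ℓ q K ρ := by
    intro K hK ρ hρ hav
    have h1 := hmany K hK ρ hρ
    have h2 : 0 < 2 ^ (K + 1) := by positivity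
    obtain ⟨n, h3, h4, v, hv, hv'⟩ := nonempty_of_ncard_ne_zero (by omega :
      {n : ℕ | ℓ K ≤ n ∧ n < ℓ (K + 1) ∧ (g (K + 1) ρ n ∩ q.poss n).Nonempty}.ncard ≠ 0)
    exact disjoint_left.1 (hav n h3 h4) hv' hv
  refine ⟨q, hpp₁.trans (hp₁p₂.trans hp₂q), k₂, N, ⟨hq, ?_, ?_, ?_⟩, ?_⟩
  · intro K hK n h1 h2
    rw [hq']
    exact hroom' K hK n h1 h2
  · intro K hK ρ hρ
    exact hmany K hK ρ fun hρE => hρ (havoid K hK ρ hρE)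
  · intro K hK
    by_contra! hcon
    have huniv : E K = Finset.univ := by
      ext ρ
      simp only [Finset.mem_univ, iff_true]
      by_contra hρ
      exact hnot K hK ρ hρ (hcon ρ)
    have h1 := hE K hK
    rw [huniv, Finset.card_univ] at h1
    simp only [Fintype.card_pi, Fintype.card_bool, Finset.prod_const, Finset.card_univ,
      Fintype.card_fin] at h1
    have h2 : 2 ^ k₂ ≤ 2 ^ (K + 1) := Nat.pow_le_pow_right (by norm_num) (by omega)
    omega
  · intro K hK
    refine le_trans ?_ (hE K hK)
    rw [← ncard_coe_finset]
    refine ncard_le_ncard (fun ρ hρ => ?_) (Finset.finite_toSet _)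
    by_contra hρE
    exact hnot K hK ρ hρE hρ

/-- If at most `N` nodes are avoided on each level, then there are at most `N²` places at which
two avoided branches split. -/
theorem finite_avoidsSplit {p : QStar C F} {k₀ N : ℕ}
    (hN : ∀ K ≥ k₀, {ρ | Avoids g ℓ p K ρ}.ncard ≤ N) : {m | AvoidsSplit g ℓ p m}.Finite := by
  classical
  by_contra hinf
  obtain ⟨B, hB, hcard⟩ := Set.Infinite.exists_subset_card_eq hinf (N * N + 1)
  have hB' : ∀ m, ∃ x y : ℕ → Bool, m ∈ B → SplitAt m x y ∧ ∀ K, Even K → m ≤ K →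
      Avoids g ℓ p K (initialNode x (K + 1)) ∧ Avoids g ℓ p K (initialNode y (K + 1)) := by
    intro m
    by_cases hm : m ∈ B
    · obtain ⟨x, y, hxy⟩ := hB hm
      exact ⟨x, y, fun _ => hxy⟩
    · exact ⟨fun _ => true, fun _ => true, fun h => absurd h hm⟩
  choose x y hxy using hB'
  obtain ⟨K, hK0, hKe, hKB⟩ : ∃ K, k₀ ≤ K ∧ Even K ∧ ∀ m ∈ B, m ≤ K := by
    refine ⟨2 * (k₀ + B.sup id), by omega, even_two_mul _, fun m hm => ?_⟩
    have : m ≤ B.sup id := Finset.le_sup (f := id) hm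
    omega
  let E : Finset (Fin (K + 1) → Bool) := Finset.univ.filter fun ρ => Avoids g ℓ p K ρ
  have hE : E.card ≤ N := by
    have := hN K hK0
    rwa [← ncard_coe_finset, Finset.coe_filter_univ]
  have hnode : ∀ u v : ℕ → Bool, initialNode u (K + 1) = initialNode v (K + 1) →
      ∀ i ≤ K, u i = v i := fun u v huv i hi => congrFun huv ⟨i, by omega⟩
  have hsplit : ∀ m ∈ B, ∀ m' ∈ B, initialNode (x m) (K + 1) = initialNode (x m') (K + 1) →
      initialNode (y m) (K + 1) = initialNode (y m') (K + 1) → ¬ m < m' := by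
    intro m hm m' hm' h1 h2 hlt
    refine (hxy m hm).1.2 ?_
    rw [hnode _ _ h1 m (hKB m hm), hnode _ _ h2 m (hKB m hm)]
    exact (hxy m' hm').1.1 m hlt
  have hle : B.card ≤ (E ×ˢ E).card := by
    refine Finset.card_le_card_of_injOn
      (fun m => (initialNode (x m) (K + 1), initialNode (y m) (K + 1))) (fun m hm => ?_) ?_
    · have := (hxy m hm).2 K hKe (hKB m hm)
      simp [E, this]
    · intro m hm m' hm' heq
      simp only [Prod.mk.injEq] at heq
      have h1 := hsplit m hm m' hm' heq.1 heq.2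
      have h2 := hsplit m' hm' m hm heq.1.symm heq.2.symm
      omega
  rw [Finset.card_product, hcard] at hle
  have := Nat.mul_le_mul hE hE
  omega

/-- Every finite sequence of bits is possible: some condition makes no restriction beyond a stem
which codes the bits read off the first levels, and the later bits are free. -/
theorem exists_decidesSeq (hC : C.IsComplete) (hb : IsSournessSystem C F g ℓ)
    (ha : ∃ f ∈ F, ∀ n, ((f n : ℕ) : ℝ≥0) ≤ C.setNorm n (univ : Set (H n)))
    (hne : ∀ n, Nonempty (H n)) (j : Bool) (η : CohenForcing) :
    ∃ p : QStar C F, DecidesSeq (DecidesBit g ℓ j) p η := by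
  classical
  have hℓ := hb.increasing
  obtain ⟨f, hf, hfn⟩ := ha
  let c : ∀ n, H n := fun n => Classical.choice (hne n)
  let s : ℕ → Bool := fun m => if hm : m < η.len then η.entry ⟨m, hm⟩ else false
  obtain ⟨p₀, hp₀, hp₀'⟩ := exists_poss_eq (F := F) hC (ℓ 0)
    (fun n => if n < ℓ 0 then {c n} else univ)
    (fun n => by
      split_ifs
      · exact singleton_nonempty _
      · exact ⟨c n, trivial⟩)
    (fun n hn => by
      rw [if_pos hn]
      exact subsingleton_singleton)
    ⟨f, hf, ℓ 0, fun n hn => by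
      rw [if_neg (by omega)]
      exact hfn n⟩
  have hhigh : ∀ n ≥ ℓ 0, p₀.poss n = univ := fun n hn => by
    rw [hp₀', if_neg (by omega)]
  obtain ⟨⟨N, hN⟩, -⟩ := exists_bound_missing hC hb p₀ hp₀ hf
    (fun n hn => by
      rw [hhigh n hn]
      exact hfn n)
  have hnonempty : ∀ K ρ n, ℓ K ≤ n → n < ℓ (K + 1) → (g (K + 1) ρ n ∩ p₀.poss n).Nonempty := by
    intro K ρ n h1 h2
    rw [hhigh n ((hℓ.monotone (Nat.zero_le K)).trans h1), inter_univ]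
    exact hb.nonempty K n h1 h2 ρ
  -- on a shorter level all `2 ^ (K + 1)` nodes would be exceptional
  have hmany : ∀ K ≥ N, 2 ^ (K + 1) ≤ ℓ (K + 1) - ℓ K := by
    intro K hK
    by_contra! hlt
    have h1 := hN K (Nat.zero_le K)
    have e : ∀ ρ, {n : ℕ | ℓ K ≤ n ∧ n < ℓ (K + 1) ∧ (g (K + 1) ρ n ∩ p₀.poss n).Nonempty} =
        (Finset.Ico (ℓ K) (ℓ (K + 1)) : Set ℕ) := by
      intro ρ
      ext n
      simp only [mem_ofPred_eq, Finset.coe_Ico, mem_Ico]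
      exact ⟨fun h => ⟨h.1, h.2.1⟩, fun h => ⟨h.1, h.2, hnonempty K ρ n h.1 h.2⟩⟩
    simp only [e, ncard_coe_finset, Nat.card_Ico, hlt, ofPred_true, ncard_univ,
      Nat.card_eq_fintype_card, Fintype.card_pi, Fintype.card_bool, Finset.prod_const,
      Finset.card_univ, Fintype.card_fin] at h1
    have : K + 1 < 2 ^ (K + 1) := Nat.lt_two_pow_self
    omega
  have hW : ∀ n, ∃ v ∈ p₀.poss n, ∀ K, ℓ K ≤ n → n < ℓ (K + 1) →
      (s (K / 2) = true → v ∈ g (K + 1) (fun _ => false) n) ∧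
      (s (K / 2) = false → ∀ ρ, v ∉ g (K + 1) ρ n) := by
    intro n
    rcases lt_or_ge n (ℓ 0) with hn | hn
    · obtain ⟨v, hv⟩ := p₀.poss_nonempty hC n
      exact ⟨v, hv, fun K hK => absurd (hℓ.monotone (Nat.zero_le K)) (by omega)⟩
    · obtain ⟨K, -, h1, h2⟩ := exists_level hℓ hn
      obtain ⟨v, hv⟩ : ∃ v, (s (K / 2) = true → v ∈ g (K + 1) (fun _ => false) n) ∧
          (s (K / 2) = false → ∀ ρ, v ∉ g (K + 1) ρ n) := by
        cases s (K / 2) with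
        | true =>
          obtain ⟨v, hv⟩ := hb.nonempty K n h1 h2 fun _ => false
          exact ⟨v, fun _ => hv, by simp⟩
        | false =>
          obtain ⟨v, -, hv⟩ := hb.room K n h1 h2
          exact ⟨v, by simp, fun _ ρ hρ => hv (mem_iUnion.2 ⟨ρ, hρ⟩)⟩
      refine ⟨v, by rw [hhigh n hn]; trivial, fun K' h3 h4 => ?_⟩
      obtain rfl := level_unique hℓ h1 h2 h3 h4
      exact hv
  choose W hW hW' using hW
  obtain ⟨q, hpq, hq, hq1, hq2⟩ := exists_ge_of_branch hC p₀ (L := ℓ N)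
    (hp₀.trans_le (hℓ.monotone (Nat.zero_le N))) W hW
  have hq2' : ∀ K ≥ N, ∀ n, ℓ K ≤ n → q.poss n = univ := by
    intro K hK n hn
    have h1 := hℓ.monotone hK
    have h2 := hℓ.monotone (Nat.zero_le K)
    rw [hq2 n (by omega), hhigh n (by omega)]
  have hnot : ∀ K ≥ N, ∀ ρ, ¬ Avoids g ℓ q K ρ := by
    intro K hK ρ hav
    have := hav (ℓ K) le_rfl (hℓ (Nat.lt_succ_self K))
    rw [hq2' K hK _ le_rfl, univ_disjoint] at this
    exact (hb.nonempty K (ℓ K) le_rfl (hℓ (Nat.lt_succ_self K)) ρ).ne_empty this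
  have hnormal : IsNormal g ℓ q N := by
    refine ⟨hq, fun K hK n h1 h2 => ?_, fun K hK ρ _ => ?_,
      fun K hK => ⟨fun _ => false, hnot K hK _⟩⟩
    · rw [hq2' K hK n h1]
      exact hb.room K n h1 h2
    · refine (hmany K hK).trans (le_of_eq ?_)
      rw [← Nat.card_Ico, ← ncard_coe_finset]
      congr 1
      ext n
      simp only [mem_ofPred_eq, Finset.coe_Ico, mem_Ico]
      refine ⟨fun h => ⟨h.1, h.2, ?_⟩, fun h => ⟨h.1, h.2.1⟩⟩
      rw [hq2' K hK n h.1, inter_univ]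
      exact hb.nonempty K n h.1 h.2 ρ
  have hsplit : ∀ m, ¬ AvoidsSplit g ℓ q m := by
    rintro m ⟨x, y, -, hxy⟩
    exact hnot _ (by omega) _ (hxy (2 * (N + m)) (even_two_mul _) (by omega)).1
  obtain ⟨r, -, hr⟩ := hnormal.exists_decidesBit hC hℓ j s η.len
    (fun m _ hm => absurd hm (hsplit m))
    (fun m _ _ hm => by
      have hn : ∀ n, n < ℓ (2 * m + 1 + 1) → q.poss n = {W n} := fun n hn =>
        hq1 n (hn.trans_le (hℓ.monotone hm))
      have hdiv : (2 * m + 1) / 2 = m := by omega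
      constructor
      · intro hs
        refine ⟨fun _ => false, fun hav => ?_⟩
        have hlt := hℓ (Nat.lt_succ_self (2 * m + 1))
        have := hav _ le_rfl hlt
        rw [hn _ hlt, disjoint_singleton_left] at this
        exact this ((hW' _ _ le_rfl hlt).1 (by rwa [hdiv]))
      · rintro ⟨ρ, hρ⟩
        by_contra hs
        refine hρ fun n h1 h2 => ?_
        rw [hn n h2, disjoint_singleton_left]
        exact (hW' n _ h1 h2).2 (by rw [hdiv]; simpa using hs) ρ)
  refine ⟨r, fun i hi => ?_⟩
  have := hr i hi
  simpa only [s, hi, dif_pos] using this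

/-- The bits read off the generic sequence form a Cohen real. -/
theorem isCohenDecision (hh : IsRegressive h) (hF : ∀ f ∈ F, ∀ n, 2 ≤ f n)
    (hFh : IsClosedUnderRegression h F) (hC : C.IsComplete) (hb : IsSournessSystem C F g ℓ)
    (hc : RemovalBound C h g ℓ)
    (ha : ∃ f ∈ F, ∀ n, ((f n : ℕ) : ℝ≥0) ≤ C.setNorm n (univ : Set (H n)))
    (hne : ∀ n, Nonempty (H n)) (j : Bool) :
    IsCohenDecision (DecidesBit g ℓ j : QStar C F → ℕ → Bool → Prop) where
  mono hpq hp := hp.mono hC hb.increasing hpq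
  consistent := DecidesBit.consistent
  possible := exists_decidesSeq hC hb ha hne j
  free p := by
    classical
    obtain ⟨q, hpq, k₀, N, hq, hN⟩ := exists_ge_isNormal hh hF hFh hC hb hc p
    obtain ⟨M, hM⟩ := (finite_avoidsSplit hN).bddAbove
    let s : ℕ → Bool := fun m => if AvoidsSplit g ℓ q m then j else
      decide (∃ ρ, ¬ Avoids g ℓ q (2 * m + 1) ρ)
    refine ⟨q, hpq, ⟨M + k₀ + 1, fun i => s i⟩, fun ν hν => ?_⟩
    have hlen : M + k₀ + 1 ≤ ν.len := hν.1
    let s' : ℕ → Bool := fun m => if hm : m < ν.len then ν.entry ⟨m, hm⟩ else false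
    have hs' : ∀ m < M + k₀ + 1, s' m = s m := by
      intro m hm
      have h1 := hν.2 m hm
      simp only [s', dif_pos (hm.trans_le hlen)]
      exact h1.symm
    obtain ⟨r, hqr, hr⟩ := hq.exists_decidesBit hC hb.increasing j s' ν.len
      (fun m _ hsplit => by
        have : m ≤ M := hM hsplit
        rw [hs' m (by omega)]
        simp only [s, if_pos hsplit])
      (fun m _ hsplit hlt => by
        rw [hs' m (by omega)]
        simp only [s, if_neg hsplit, decide_eq_true_eq])
    refine ⟨r, hqr, fun i hi => ?_⟩
    have := hr i hi
    simpa only [s', hi, dif_pos] using this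

end CreatingPair.QStar

/-! ### Compatibility and the countable chain condition -/

namespace CreatingPair.QStar

variable {H : ℕ → Type*} {D : Type*} {C : CreatingPair H D} {F : Set (ℕ → ℕ)}
variable {g : ∀ k : ℕ, (Fin k → Bool) → ∀ i : ℕ, Set (H i)} {ℓ : ℕ → ℕ} {h : ℕ → ℕ → ℕ}

/-- Two conditions are compatible as soon as their sets of possibilities meet everywhere: the
requirement on the norms is then automatic, because the pair is linked and the family is directed
and `h`-closed. -/
theorem compat_iff (hF : ∀ f ∈ F, ∀ n, 2 ≤ f n) (hFh : IsClosedUnderRegression h F)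
    (hFd : IsGeStarDirected F) (hC : C.IsComplete) (hlink : C.IsLinkedBy h) {p q : QStar C F} :
    Compat p q ↔ ∀ n, (p.poss n ∩ q.poss n).Nonempty := by
  constructor
  · rintro ⟨r, hpr, hqr⟩ n
    exact (r.poss_nonempty hC n).mono
      (subset_inter (((le_iff hC).1 hpr).2 n) (((le_iff hC).1 hqr).2 n))
  · intro hpq
    obtain ⟨f₀, hf₀, a₀, h₀⟩ := exists_norm_le hC p
    obtain ⟨f₁, hf₁, a₁, h₁⟩ := exists_norm_le hC q
    obtain ⟨f₂, hf₂, h₂⟩ := hFd f₀ hf₀ f₁ hf₁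
    obtain ⟨a₂, h₂⟩ := eventually_atTop.1 h₂
    obtain ⟨f₃, hf₃, h₃⟩ := hFh f₂ hf₂
    obtain ⟨a₃, h₃⟩ := eventually_atTop.1 h₃
    obtain ⟨r, hr, hr'⟩ := exists_poss_eq (F := F) hC (max p.len q.len)
      (fun n => p.poss n ∩ q.poss n) hpq
      (fun n hn => by
        rcases lt_max_iff.1 hn with hn | hn
        · exact (p.poss_subsingleton hn).anti inter_subset_left
        · exact (q.poss_subsingleton hn).anti inter_subset_right)
      ⟨f₃, hf₃, max (max a₀ a₁) (max a₂ a₃), fun n hn => by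
        have hle := h₂ n (by omega)
        have hle₀ : ((f₂ n : ℕ) : ℝ≥0) ≤ C.setNorm n (p.poss n) :=
          le_trans (by exact_mod_cast hle.trans (min_le_left _ _)) (h₀ n (by omega))
        have hle₁ : ((f₂ n : ℕ) : ℝ≥0) ≤ C.setNorm n (q.poss n) :=
          le_trans (by exact_mod_cast hle.trans (min_le_right _ _)) (h₁ n (by omega))
        refine le_trans ?_ (setNorm_inter hC hlink (hF f₂ hf₂ n) hle₀ hle₁).2
        exact_mod_cast h₃ n (by omega)⟩
    refine ⟨r, (le_iff hC).2 ⟨hr ▸ le_max_left _ _, fun n => ?_⟩,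
      (le_iff hC).2 ⟨hr ▸ le_max_right _ _, fun n => ?_⟩⟩
    · rw [hr']
      exact inter_subset_left
    · rw [hr']
      exact inter_subset_right

/-- The conditions with the same stem, whose norms beyond the stem are bounded from below by the
same function of the family, are pairwise compatible; and there are countably many pairs of a stem
and a function. -/
theorem isCCC [∀ n, Countable (H n)] (hF : ∀ f ∈ F, ∀ n, 2 ≤ f n) (hFc : F.Countable)
    (hFh : IsClosedUnderRegression h F) (hFd : IsGeStarDirected F) (hC : C.IsComplete)
    (hlink : C.IsLinkedBy h) : IsCCC (QStar C F) := by
  intro A hA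
  have key : ∀ p : QStar C F, ∃ q, p ≤ q ∧ ∃ f ∈ F, ∀ n ≥ q.len,
      ((f n : ℕ) : ℝ≥0) ≤ C.setNorm n (q.poss n) := by
    intro p
    obtain ⟨f, hf, a, ha⟩ := exists_norm_le hC p
    obtain ⟨q, hpq, hq, hq'⟩ := exists_ge_len_eq hC p (le_max_left p.len a)
    refine ⟨q, hpq, f, hf, fun n hn => ?_⟩
    rw [hq] at hn
    rw [hq' n hn]
    exact ha n ((le_max_right _ _).trans hn)
  choose q hq f hf hqf using key
  refine MapsTo.countable_of_injOn (f := fun p => ((q p).1.w, f p)) (t := univ ×ˢ F)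
    (fun p _ => ⟨trivial, hf p⟩) (fun p hp p' hp' heq => ?_) (countable_univ.prod hFc)
  simp only [Prod.mk.injEq] at heq
  by_contra hne
  have hcompat : Compat (q p) (q p') := by
    rw [compat_iff hF hFh hFd hC hlink]
    intro n
    rcases lt_or_ge n (q p).len with hn | hn
    · obtain ⟨v, hv⟩ := (q p).poss_nonempty hC n
      refine ⟨v, hv, ?_⟩
      rw [poss, Condition.poss_of_lt _ hn] at hv
      rw [poss, Condition.poss_of_lt _ (show n < (q p').1.w.len by rw [← heq.1]; exact hn),
        mem_singleton_iff.1 hv]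
      exact (le_of_eq heq.1).2 n hn
    · have h1 := hqf p n hn
      have h2 := hqf p' n (by rw [len, ← heq.1]; exact hn)
      rw [← heq.2] at h2
      exact (setNorm_inter hC hlink (hF _ (hf p) n) h1 h2).1
  obtain ⟨r, h1, h2⟩ := hcompat
  exact hA p hp p' hp' hne ⟨r, (hq p).trans h1, (hq p').trans h2⟩

/-! ### The coding of conditions -/

/-- The code of the condition with stem `w` and sets of possibilities `A n`, for `n ≥ lh w`. -/
noncomputable def codeOf (w : FinSeq H) (A : ∀ n, Set (H n)) :
    FinSeq H × (ℕ → FinSeq H × FinSeq H → Bool) :=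
  (w, fun i y => by
    classical exact decide (y.1.len = w.len + i ∧ y.2.len = w.len + i + 1 ∧ y.1 ≤ y.2 ∧
      ∃ h : w.len + i < y.2.len, y.2.entry ⟨w.len + i, h⟩ ∈ A (w.len + i)))

theorem code_eq (hC : C.IsComplete) (p : QStar C F) :
    code C F p = codeOf p.1.w p.poss := by
  refine Prod.ext rfl ?_
  funext i y
  simp only [code, codeOf]
  refine decide_eq_decide.2 ?_
  rw [mem_val_iff hC (p.1.mem i), Condition.mdn_eq hC, poss, Condition.poss_add]

/-! ### The predense families -/

/-- The condition `p` has the stem `w` and the only restriction beyond it is that the nodes on the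
branch `x` must not be hit. -/
def IsBranchCondition (g : ∀ k : ℕ, (Fin k → Bool) → ∀ i : ℕ, Set (H i)) (ℓ : ℕ → ℕ)
    (w : FinSeq H) (x : ℕ → Bool) (p : QStar C F) : Prop :=
  p.1.w = w ∧ ∀ n ≥ w.len, p.poss n =
    {v | ∀ K, ℓ K ≤ n → n < ℓ (K + 1) → v ∉ g (K + 1) (initialNode x (K + 1)) n}

/-- Branch conditions satisfy the requirement on the norms because only one node per level is
removed from the full sets of possibilities. -/
theorem exists_isBranchCondition (hh : IsRegressive h) (hF : ∀ f ∈ F, ∀ n, 2 ≤ f n)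
    (hFh : IsClosedUnderRegression h F) (hC : C.IsComplete) (hb : IsSournessSystem C F g ℓ)
    (hc : RemovalBound C h g ℓ)
    (ha : ∃ f ∈ F, ∀ n, ((f n : ℕ) : ℝ≥0) ≤ C.setNorm n (univ : Set (H n)))
    (hne : ∀ n, Nonempty (H n)) (w : FinSeq H) (x : ℕ → Bool) :
    ∃ p : QStar C F, IsBranchCondition g ℓ w x p := by
  classical
  have hℓ := hb.increasing
  obtain ⟨f, hf, hfn⟩ := ha
  let B : ∀ n, Set (H n) := fun n =>
    {v | ∀ K, ℓ K ≤ n → n < ℓ (K + 1) → v ∉ g (K + 1) (initialNode x (K + 1)) n}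
  have hB : ∀ K n, ℓ K ≤ n → n < ℓ (K + 1) →
      B n = univ \ ⋃ ρ ∈ ({initialNode x (K + 1)} : Finset _), g (K + 1) ρ n := by
    intro K n h1 h2
    ext v
    simp only [B, mem_ofPred_eq, Finset.mem_singleton, iUnion_iUnion_eq_left, Set.mem_sdiff,
      mem_univ, true_and]
    refine ⟨fun hv => hv K h1 h2, fun hv K' h3 h4 => ?_⟩
    obtain rfl := level_unique hℓ h1 h2 h3 h4
    exact hv
  have hBne : ∀ n, (B n).Nonempty := by
    intro n
    rcases lt_or_ge n (ℓ 0) with hn | hn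
    · obtain ⟨v⟩ := hne n
      exact ⟨v, fun K hK => absurd (hℓ.monotone (Nat.zero_le K)) (by omega)⟩
    · obtain ⟨K, -, h1, h2⟩ := exists_level hℓ hn
      rw [hB K n h1 h2]
      exact (hb.room K n h1 h2).mono (sdiff_subset_sdiff_right
        (iUnion₂_subset fun ρ _ => subset_iUnion (fun ρ => g (K + 1) ρ n) ρ))
  obtain ⟨f', hf', a, ha⟩ := exists_norm_le_diff hh hF hFh hc (fun n => (univ : Set (H n)))
    (k₀ := 0) (fun K _ n => hb.room K n) hf (a := 0) (fun n _ => hfn n) 1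
  obtain ⟨p, hp, hp'⟩ := exists_poss_eq (F := F) hC w.len
    (fun n => if hn : n < w.len then {w.entry ⟨n, hn⟩} else B n)
    (fun n => by
      split_ifs
      · exact singleton_nonempty _
      · exact hBne n)
    (fun n hn => by
      rw [dif_pos hn]
      exact subsingleton_singleton)
    ⟨f', hf', max a (max w.len (ℓ 0)), fun n hn => by
      obtain ⟨K, -, h1, h2⟩ := exists_level hℓ (show ℓ 0 ≤ n by omega)
      rw [dif_neg (by omega), hB K n h1 h2]
      exact ha n (by omega) K (Nat.zero_le K) h1 h2 _ (by simp)⟩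
  refine ⟨p, FinSeq.ext_entry hp fun i hi hi' => ?_, fun n hn => ?_⟩
  · have := hp' i
    rw [dif_pos hi', poss, Condition.poss_of_lt _ hi] at this
    exact singleton_injective this
  · rw [hp', dif_neg (not_lt.2 hn)]

/-- A condition extending two branch conditions for branches that split at `m`, whose stems are
not too long, avoids a pair of branches splitting at `m`. -/
theorem avoidsSplit_of_isBranchCondition (hC : C.IsComplete) (hℓ : StrictMono ℓ) {w : FinSeq H}
    {x y : ℕ → Bool} {m : ℕ} (hw : w.len ≤ ℓ m) (hxy : SplitAt m x y) {p p' q : QStar C F}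
    (hp : IsBranchCondition g ℓ w x p) (hp' : IsBranchCondition g ℓ w y p') (hpq : p ≤ q)
    (hpq' : p' ≤ q) : AvoidsSplit g ℓ q m := by
  have key : ∀ {z : ℕ → Bool} {r : QStar C F}, IsBranchCondition g ℓ w z r → r ≤ q →
      ∀ K, m ≤ K → Avoids g ℓ q K (initialNode z (K + 1)) := by
    intro z r hr hrq K hK n h1 h2
    have h3 := ((le_iff hC).1 hrq).2 n
    rw [hr.2 n (hw.trans ((hℓ.monotone hK).trans h1))] at h3
    exact disjoint_left.2 fun v hv => h3 hv K h1 h2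
  exact ⟨x, y, hxy, fun K _ hK => ⟨key hp hpq K hK, key hp' hpq' K hK⟩⟩

/-- Each condition is compatible with a branch condition, for any given branch, since it has an
extension for which it is always possible to hit no node at all. -/
theorem exists_compat_isBranchCondition (hh : IsRegressive h) (hF : ∀ f ∈ F, ∀ n, 2 ≤ f n)
    (hFh : IsClosedUnderRegression h F) (hFd : IsGeStarDirected F) (hC : C.IsComplete)
    (hlink : C.IsLinkedBy h) (hb : IsSournessSystem C F g ℓ) (hc : RemovalBound C h g ℓ)
    (p : QStar C F) : ∃ (w : FinSeq H), ∀ x, ∀ q : QStar C F, IsBranchCondition g ℓ w x q →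
      Compat p q := by
  obtain ⟨p', hpp', k₀, -, hp', -⟩ := exists_ge_isNormal hh hF hFh hC hb hc p
  refine ⟨p'.1.w, fun x q hq => ?_⟩
  suffices hcompat : Compat p' q by
    obtain ⟨r, h1, h2⟩ := hcompat
    exact ⟨r, hpp'.trans h1, h2⟩
  rw [compat_iff hF hFh hFd hC hlink]
  intro n
  have hlen : p'.1.w.len = ℓ k₀ := hp'.len_eq
  rcases lt_or_ge n (ℓ k₀) with hn | hn
  · obtain ⟨v, hv⟩ := p'.poss_nonempty hC n
    refine ⟨v, hv, ?_⟩
    rw [poss, Condition.poss_of_lt _ (hn.trans_eq hlen.symm)] at hv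
    rw [poss, Condition.poss_of_lt _ (show n < q.1.w.len by rw [hq.1]; omega),
      mem_singleton_iff.1 hv]
    exact (le_of_eq hq.1.symm).2 n _
  · obtain ⟨K, hK, h1, h2⟩ := exists_level hb.increasing hn
    obtain ⟨v, hv, hv'⟩ := hp'.room K hK n h1 h2
    refine ⟨v, hv, ?_⟩
    rw [hq.2 n (hlen.trans_le hn)]
    intro K' h3 h4
    obtain rfl := level_unique hb.increasing h1 h2 h3 h4
    exact fun hmem => hv' (mem_iUnion.2 ⟨_, hmem⟩)

/-- The code of a branch condition depends continuously on the branch. -/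
theorem continuous_codeOf_branch (hℓ : StrictMono ℓ) (w : FinSeq H) :
    Continuous fun x : ℕ → Bool => codeOf w fun n =>
      {v | ∀ K, ℓ K ≤ n → n < ℓ (K + 1) → v ∉ g (K + 1) (initialNode x (K + 1)) n} := by
  classical
  refine continuous_const.prodMk (continuous_pi fun i => continuous_pi fun y => ?_)
  -- only the node of the branch on the level of the place `lh w + i` matters
  obtain ⟨K, hK⟩ : ∃ K, ∀ K', ℓ K' ≤ w.len + i → w.len + i < ℓ (K' + 1) → K' = K := by
    by_cases hex : ∃ K, ℓ K ≤ w.len + i ∧ w.len + i < ℓ (K + 1)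
    · obtain ⟨K, h1, h2⟩ := hex
      exact ⟨K, fun K' h3 h4 => level_unique hℓ h1 h2 h3 h4⟩
    · exact ⟨0, fun K' h1 h2 => absurd ⟨K', h1, h2⟩ hex⟩
  have key : (fun x : ℕ → Bool => (codeOf w fun n =>
      {v | ∀ K, ℓ K ≤ n → n < ℓ (K + 1) → v ∉ g (K + 1) (initialNode x (K + 1)) n}).2 i y) =
      (fun ρ : Fin (K + 1) → Bool => decide (y.1.len = w.len + i ∧ y.2.len = w.len + i + 1 ∧
        y.1 ≤ y.2 ∧ ∃ h : w.len + i < y.2.len, ℓ K ≤ w.len + i → w.len + i < ℓ (K + 1) →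
          y.2.entry ⟨w.len + i, h⟩ ∉ g (K + 1) ρ (w.len + i))) ∘
        fun x => initialNode x (K + 1) := by
    funext x
    simp only [codeOf, Function.comp]
    refine decide_eq_decide.2 (and_congr_right fun _ => and_congr_right fun _ =>
      and_congr_right fun _ => exists_congr fun hlt => ⟨fun hv => hv K, fun hv K' h1 h2 => ?_⟩)
    obtain rfl := hK K' h1 h2
    exact hv h1 h2
  exact (key ▸ continuous_of_discreteTopology.comp (continuous_initialNode (K + 1)) :)

/-! ### Sourness over Cohen -/

theorem veryExplicitlySourOver [∀ n, Countable (H n)] (hh : IsRegressive h)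
    (hF : ∀ f ∈ F, ∀ n, 2 ≤ f n) (hFc : F.Countable) (hFh : IsClosedUnderRegression h F)
    (hFd : IsGeStarDirected F) (hC : C.IsComplete) (hlink : C.IsLinkedBy h)
    (hb : IsSournessSystem C F g ℓ) (hc : RemovalBound C h g ℓ)
    (ha : ∃ f ∈ F, ∀ n, ((f n : ℕ) : ℝ≥0) ≤ C.setNorm n (univ : Set (H n)))
    (hne : ∀ n, Nonempty (H n)) : VeryExplicitlySourOver cohenName (code C F) := by
  have hℓ := hb.increasing
  have hdec := isCohenDecision hh hF hFh hC hb hc ha hne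
  choose τ hτ using fun j => (hdec j).exists_standardName (isCCC hF hFc hFh hFd hC hlink)
  have : Nonempty (FinSeq H) := ⟨⟨0, fun i => i.elim0⟩⟩
  obtain ⟨e, he⟩ := exists_surjective_nat (FinSeq H)
  -- an enumeration of the stems in which the lengths grow slowly
  let w : ℕ → FinSeq H := fun k => (e k.unpair.1).res (ℓ (k + 1))
  have hw : ∀ u : FinSeq H, ∃ k, w k = u := by
    intro u
    obtain ⟨a, rfl⟩ := he u
    refine ⟨Nat.pair a (e a).len, ?_⟩
    have hle : (e a).len ≤ ℓ (Nat.pair a (e a).len + 1) :=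
      (Nat.right_le_pair a _).trans ((Nat.le_succ _).trans hℓ.le_apply)
    refine FinSeq.ext_entry ?_ fun i hi hi' => ?_
    · simp only [w, Nat.unpair_pair, FinSeq.res]
      exact min_eq_right hle
    · have hea : e (Nat.unpair (Nat.pair a (e a).len)).1 = e a := by rw [Nat.unpair_pair]
      exact (le_of_eq hea).2 i _
  choose G hG using fun (x : ℕ → Bool) (k : ℕ) =>
    exists_isBranchCondition (F := F) hh hF hFh hC hb hc ha hne (w k) x
  have hcode : ∀ x k, code C F (G x k) = codeOf (w k) fun n =>
      {v | ∀ K, ℓ K ≤ n → n < ℓ (K + 1) → v ∉ g (K + 1) (initialNode x (K + 1)) n} := by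
    intro x k
    rw [code_eq hC, (hG x k).1]
    simp only [codeOf]
    refine Prod.ext rfl (funext fun i => funext fun y => decide_eq_decide.2 ?_)
    rw [(hG x k).2 _ (Nat.le_add_right _ _)]
  have hcont : Continuous fun y : (ℕ → Bool) × ℕ => code C F (G y.1 y.2) := by
    rw [continuous_prod_of_discrete_right]
    intro k
    simp only [hcode]
    exact continuous_codeOf_branch hℓ (w k)
  have hmeas : @Measurable _ _ (borel (Branch (fun _ : ℕ => Bool) × ℕ))
      (borel (FinSeq H × (ℕ → FinSeq H × FinSeq H → Bool)))
      (fun y => code C F (G y.1 y.2)) := by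
    borelize (Branch (fun _ : ℕ => Bool) × ℕ) (FinSeq H × (ℕ → FinSeq H × FinSeq H → Bool))
    have hcont' : Continuous fun y : Branch (fun _ : ℕ => Bool) × ℕ => code C F (G y.1 y.2) :=
      hcont
    exact hcont'.measurable
  have hpred : ∀ x : ℕ → Bool, IsPredense (range fun k => G x k) := by
    intro x p
    obtain ⟨u, hu⟩ := exists_compat_isBranchCondition hh hF hFh hFd hC hlink hb hc p
    obtain ⟨k, rfl⟩ := hw u
    exact ⟨G x k, mem_range_self k, hu x _ (hG x k)⟩
  refine ⟨τ false, τ true, (hdec false).isCopyOf_cohenName (hτ false),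
    (hdec true).isCopyOf_cohenName (hτ true), fun y => G y.1 y.2, fun y => G y.1 y.2,
    hmeas, hmeas, hpred, hpred, ?_⟩
  intro x y m k₀ k₁ hxy hagree hk₀ hk₁
  obtain ⟨m', hm', hsplit⟩ : ∃ m' ≥ m, SplitAt m' x y := by
    have hex : ∃ i, x i ≠ y i := Function.ne_iff.1 hxy
    classical
    refine ⟨Nat.find hex, ?_, fun i hi => not_not.1 (Nat.find_min hex hi), Nat.find_spec hex⟩
    by_contra hlt
    exact Nat.find_spec hex (hagree _ (by omega))
  have hforce : ∀ (j : Bool) (k : ℕ), k < m → ∀ q, G x k ≤ q → G y k ≤ q →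
      (τ j).Forces q (m' + 1) {a | a ⟨m', Nat.lt_succ_self m'⟩ = j} := by
    intro j k hk q hq hq'
    have hwk : (w k).len ≤ ℓ m' :=
      (min_le_left _ _).trans (hℓ.monotone (by omega))
    exact (hdec j).forces_of_dec (hτ j) (Or.inl ⟨avoidsSplit_of_isBranchCondition hC hℓ hwk hsplit
      (hG x k) (hG y k) hq hq', rfl⟩)
  refine ⟨m' + 1, _, _, ?_, hforce false k₀ hk₀, hforce true k₁ hk₁⟩
  rw [disjoint_left]
  intro a ha ha'
  rw [mem_ofPred_eq] at ha ha'
  exact Bool.false_ne_true (ha.symm.trans ha')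

end CreatingPair.QStar

/-! ### Definability -/

theorem MeasureTheory.AnalyticSet.inter {X : Type*} [TopologicalSpace X] [T2Space X] {s t : Set X}
    (hs : MeasureTheory.AnalyticSet s) (ht : MeasureTheory.AnalyticSet t) :
    MeasureTheory.AnalyticSet (s ∩ t) := by
  rw [inter_eq_iInter]
  exact MeasureTheory.AnalyticSet.iInter fun b => by cases b <;> assumption

namespace CreatingPair.QStar

open MeasureTheory

variable {H : ℕ → Type*} {D : Type*} {C : CreatingPair H D} {F : Set (ℕ → ℕ)} {h : ℕ → ℕ → ℕ}

instance : DiscreteTopology (FinSeq H) := ⟨rfl⟩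

/-- The Polish space of the codes `(w, A)`, where `w` is a stem and `A n` is (the characteristic
function of) the set of possible values at `n`. -/
abbrev PossSpace (H : ℕ → Type*) : Type _ := FinSeq H × (∀ n, H n → Bool)

/-- The stem of a condition together with its sets of possibilities. -/
noncomputable def possCode (p : QStar C F) : PossSpace H :=
  (p.1.w, fun n v => by classical exact decide (v ∈ p.poss n))

theorem possCode_apply (p : QStar C F) (n : ℕ) (v : H n) :
    (possCode p).2 n v = true ↔ v ∈ p.poss n := by
  simp [possCode]

theorem possCode_sets (p : QStar C F) (n : ℕ) : {v | (possCode p).2 n v = true} = p.poss n :=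
  ext fun v => possCode_apply p n v

theorem code_eq_codeOf_possCode (hC : C.IsComplete) (p : QStar C F) :
    code C F p = codeOf (possCode p).1 fun n => {v | (possCode p).2 n v = true} := by
  simp only [possCode_sets]
  exact code_eq hC p

theorem continuous_codeOf : Continuous fun y : PossSpace H =>
    codeOf y.1 fun n => {v | y.2 n v = true} := by
  classical
  rw [continuous_prod_of_discrete_left]
  intro w
  refine continuous_const.prodMk (continuous_pi fun i => continuous_pi fun y => ?_)
  simp only [mem_ofPred_eq]
  by_cases hlt : w.len + i < y.2.len
  · have : Continuous fun A : ∀ n, H n → Bool => A (w.len + i) (y.2.entry ⟨w.len + i, hlt⟩) := by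
      fun_prop
    refine (continuous_of_discreteTopology (f := fun b : Bool => decide (y.1.len = w.len + i ∧
      y.2.len = w.len + i + 1 ∧ y.1 ≤ y.2 ∧ b = true))).comp this |>.congr fun A => ?_
    refine decide_eq_decide.2 ?_
    simp [hlt]
  · refine (continuous_const (y := false)).congr fun A => ?_
    simp [hlt]

theorem code_injective (hC : C.IsComplete) : Function.Injective (code C F) := by
  intro p q hpq
  have hw : p.1.w = q.1.w := congrArg Prod.fst hpq
  have hlen : p.1.w.len = q.1.w.len := by rw [hw]
  refine poss_injective hC hlen fun n => ?_
  rcases lt_or_ge n p.1.w.len with hn | hn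
  · rw [poss, poss, Condition.poss_of_lt _ hn, Condition.poss_of_lt _ (hlen ▸ hn)]
    exact congrArg _ ((le_of_eq hw).2 n hn)
  · obtain ⟨i, rfl⟩ := Nat.exists_eq_add_of_le hn
    have hval : (p.1.t i).val = (q.1.t i).val := by
      ext y
      have := congrFun (congrFun (congrArg Prod.snd hpq) i) y
      simpa only [code, decide_eq_decide] using this
    rw [poss, Condition.poss_add, poss, Condition.poss_of_le _ (hlen ▸ hn),
      show p.1.w.len + i - q.1.w.len = i by omega]
    simp only [Creature.pos, hval]

theorem measurableSet_coord {X : Type*} [TopologicalSpace X] [MeasurableSpace X] [BorelSpace X]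
    {φ : X → PossSpace H} (hφ : Continuous φ) (n : ℕ) (v : H n) :
    MeasurableSet {x | (φ x).2 n v = true} := by
  have : Continuous fun x => (φ x).2 n v := by fun_prop
  exact ((isClosed_discrete {true}).preimage this).measurableSet

/-- As there are countably many stems, measurability may be checked for each stem separately. -/
theorem measurableSet_stem [∀ n, Countable (H n)] {X : Type*} [TopologicalSpace X]
    [MeasurableSpace X] [BorelSpace X]
    {φ : X → PossSpace H} (hφ : Continuous φ) {P : FinSeq H → X → Prop}
    (hP : ∀ w, MeasurableSet {x | P w x}) : MeasurableSet {x | P (φ x).1 x} := by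
  have e : {x | P (φ x).1 x} = ⋃ w, {x | (φ x).1 = w} ∩ {x | P w x} := by
    ext x
    simp
  rw [e]
  have : Continuous fun x => (φ x).1 := by fun_prop
  exact MeasurableSet.iUnion fun w =>
    ((isClosed_discrete {w}).preimage this).measurableSet.inter (hP w)

theorem range_possCode (hC : C.IsComplete) :
    range (possCode : QStar C F → PossSpace H) =
      {y | ∀ n, ∃ v, y.2 n v = true} ∩
      {y | ∀ n (hn : n < y.1.len) v, y.2 n v = true ↔ v = y.1.entry ⟨n, hn⟩} ∩
      ⋃ f : F, ⋃ a : ℕ, ⋂ n : ℕ, {y | a ≤ n →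
        ∃ t, C.IsAt n {v | y.2 n v = true} t ∧ ((f.1 n : ℕ) : ℝ≥0) ≤ t.nor} := by
  ext y
  simp only [mem_inter_iff, mem_ofPred_eq, mem_iUnion, mem_iInter]
  constructor
  · rintro ⟨p, rfl⟩
    refine ⟨⟨fun n => ?_, fun n hn v => ?_⟩, ?_⟩
    · obtain ⟨v, hv⟩ := p.poss_nonempty hC n
      exact ⟨v, (possCode_apply p n v).2 hv⟩
    · rw [possCode_apply, poss, Condition.poss_of_lt _ hn]
      rfl
    · obtain ⟨f, hf, a, ha⟩ := exists_norm_le hC p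
      refine ⟨⟨f, hf⟩, a, fun n hn => ?_⟩
      rw [possCode_sets]
      obtain ⟨t, ht, -⟩ := hC.2.2.1 n _ (p.poss_nonempty hC n)
      exact ⟨t, ht, setNorm_eq hC ht ▸ ha n hn⟩
  · rintro ⟨⟨h1, h2⟩, f, a, h3⟩
    obtain ⟨p, hp, hp'⟩ := exists_poss_eq (F := F) hC y.1.len (fun n => {v | y.2 n v = true}) h1
      (fun n hn v hv v' hv' => ((h2 n hn v).1 hv).trans ((h2 n hn v').1 hv').symm)
      ⟨f, f.2, a, fun n hn => by
        obtain ⟨t, ht, hle⟩ := h3 n hn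
        rwa [setNorm_eq hC ht]⟩
    refine ⟨p, Prod.ext (FinSeq.ext_entry hp fun i hi hi' => ?_) (funext fun n => funext fun v =>
      Bool.eq_iff_iff.2 ?_)⟩
    · refine (h2 i hi' _).1 ?_
      have : p.1.w.entry ⟨i, hi⟩ ∈ p.poss i := by
        rw [poss, Condition.poss_of_lt _ hi]
        rfl
      rw [hp'] at this
      exact this
    · rw [possCode_apply, hp']
      rfl

variable [∀ n, Countable (H n)]

instance : PolishSpace (PossSpace H) := inferInstance

theorem analyticSet_range_possCode (hC : C.IsComplete) (hFc : F.Countable)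
    (hnor : C.HasAnalyticNorms) :
    AnalyticSet (range (possCode : QStar C F → PossSpace H)) := by
  rw [range_possCode hC]
  refine AnalyticSet.inter ?_ ?_
  · borelize (PossSpace H)
    refine MeasurableSet.analyticSet (MeasurableSet.inter ?_ ?_)
    · simp only [ofPred_forall, ofPred_exists]
      exact MeasurableSet.iInter fun n => MeasurableSet.iUnion fun v =>
        measurableSet_coord continuous_id n v
    · refine measurableSet_stem (φ := id) continuous_id (P := fun w y =>
        ∀ n (hn : n < w.len) v, y.2 n v = true ↔ v = w.entry ⟨n, hn⟩) fun w => ?_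
      simp only [ofPred_forall]
      refine MeasurableSet.iInter fun n => MeasurableSet.iInter fun hn =>
        MeasurableSet.iInter fun v => ?_
      exact (measurableSet_coord continuous_id n v).iff (MeasurableSet.const _)
  · have := hFc.to_subtype
    refine AnalyticSet.iUnion fun f => AnalyticSet.iUnion fun a => AnalyticSet.iInter fun n => ?_
    by_cases hn : a ≤ n
    · simp only [hn, true_implies]
      have hcont : Continuous fun y : PossSpace H => y.2 n := by fun_prop
      exact (hnor n (f.1 n)).preimage hcont
    · simp only [hn, false_implies, ofPred_true]
      exact isClosed_univ.analyticSet

/-- A relation between conditions which is Borel in terms of stems and possibilities is `Σ¹₁` in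
terms of the codes of the conditions. -/
theorem analyticSet_of_measurableSet (hC : C.IsComplete) (hFc : F.Countable)
    (hnor : C.HasAnalyticNorms) {R : QStar C F → QStar C F → Prop}
    {S : Set (PossSpace H × PossSpace H)}
    (hS : @MeasurableSet _ (borel (PossSpace H × PossSpace H)) S)
    (hRS : ∀ p q, R p q ↔ (possCode p, possCode q) ∈ S) :
    AnalyticSet {z | ∃ p q : QStar C F, R p q ∧ z = (code C F p, code C F q)} := by
  have hran := analyticSet_range_possCode hC hFc hnor
  have hS' : AnalyticSet S := by
    borelize (PossSpace H × PossSpace H)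
    exact hS.analyticSet
  have h1 := AnalyticSet.inter (AnalyticSet.inter
    (hran.preimage (continuous_fst (X := PossSpace H) (Y := PossSpace H)))
    (hran.preimage (continuous_snd (X := PossSpace H) (Y := PossSpace H)))) hS'
  have h2 := h1.image_of_continuous ((continuous_codeOf (H := H)).prodMap continuous_codeOf)
  convert h2 using 1
  ext z
  constructor
  · rintro ⟨p, q, hpq, rfl⟩
    refine ⟨(possCode p, possCode q), ⟨⟨⟨p, rfl⟩, ⟨q, rfl⟩⟩, (hRS p q).1 hpq⟩, ?_⟩
    rw [code_eq_codeOf_possCode hC, code_eq_codeOf_possCode hC]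
    rfl
  · rintro ⟨⟨y, y'⟩, ⟨⟨⟨p, rfl⟩, ⟨q, rfl⟩⟩, hy⟩, rfl⟩
    refine ⟨p, q, (hRS p q).2 hy, ?_⟩
    rw [code_eq_codeOf_possCode hC, code_eq_codeOf_possCode hC]
    rfl

theorem isSouslin (hF : ∀ f ∈ F, ∀ n, 2 ≤ f n) (hFc : F.Countable)
    (hFh : IsClosedUnderRegression h F) (hFd : IsGeStarDirected F) (hC : C.IsComplete)
    (hlink : C.IsLinkedBy h) (hnor : C.HasAnalyticNorms) : IsSouslin (code C F) := by
  refine ⟨code_injective hC, ?_, ?_, ?_⟩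
  · have h1 := (analyticSet_range_possCode hC hFc hnor).image_of_continuous continuous_codeOf
    rw [← range_comp] at h1
    convert h1 using 2
    funext p
    exact code_eq_codeOf_possCode hC p
  · refine analyticSet_of_measurableSet hC hFc hnor
      (S := {z : PossSpace H × PossSpace H | z.1.1.len ≤ z.2.1.len} ∩
        {z : PossSpace H × PossSpace H | ∀ n v, z.2.2 n v = true → z.1.2 n v = true})
      ?_ fun p q => ?_
    · borelize (PossSpace H × PossSpace H)
      refine MeasurableSet.inter ?_ ?_
      · refine measurableSet_stem (φ := Prod.fst) continuous_fst
          (P := fun w (z : PossSpace H × PossSpace H) => w.len ≤ z.2.1.len) fun w => ?_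
        refine measurableSet_stem (φ := Prod.snd) continuous_snd
          (P := fun w' (_ : PossSpace H × PossSpace H) => w.len ≤ w'.len)
          fun w' => MeasurableSet.const _
      · simp only [ofPred_forall]
        exact MeasurableSet.iInter fun n => MeasurableSet.iInter fun v =>
          (measurableSet_coord continuous_snd n v).imp (measurableSet_coord continuous_fst n v)
    · rw [le_iff hC]
      refine and_congr_right fun _ => forall_congr' fun n => forall_congr' fun v => ?_
      simp only [possCode_apply]
  · refine analyticSet_of_measurableSet hC hFc hnor
      (S := {z : PossSpace H × PossSpace H | ∀ n, ∃ v, z.1.2 n v = true ∧ z.2.2 n v = true}ᶜ)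
      ?_ fun p q => ?_
    · borelize (PossSpace H × PossSpace H)
      refine MeasurableSet.compl ?_
      simp only [ofPred_forall, ofPred_exists]
      exact MeasurableSet.iInter fun n => MeasurableSet.iUnion fun v =>
        (measurableSet_coord continuous_fst n v).inter (measurableSet_coord continuous_snd n v)
    · rw [compat_iff hF hFh hFd hC hlink, mem_compl_iff, mem_ofPred_eq]
      simp only [possCode_apply]
      rfl

end CreatingPair.QStar

theorem mainTheorem3 {H : ℕ → Type*} [∀ n, Countable (H n)] [∀ n, Nontrivial (H n)] {D : Type*}
    (h : ℕ → ℕ → ℕ) (hh : IsRegressive h)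
    (F : Set (ℕ → ℕ)) (hF : ∀ f ∈ F, ∀ n, 2 ≤ f n) (hFc : F.Countable)
    (hFh : IsClosedUnderRegression h F) (hFd : IsGeStarDirected F)
    (C : CreatingPair H D) (hloc : C.IsLocal) (hlink : C.IsLinkedBy h) (hcomp : C.IsComplete)
    (ha : ∃ f ∈ F, ∀ (n : ℕ) (t : Creature H D), C.IsAt n univ t → ((f n : ℕ) : NNReal) ≤ t.nor)
    (g : ∀ k : ℕ, (Fin k → Bool) → ∀ i : ℕ, Set (H i)) (ℓ : ℕ → ℕ)
    (hb : IsSournessSystem C F g ℓ)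
    (hc : ∀ (k n : ℕ) (A : Set (H n)) (ρ : Fin (k + 1) → Bool), ℓ k ≤ n → n < ℓ (k + 1) →
      (A \ g (k + 1) ρ n).Nonempty → ∀ s t : Creature H D,
        C.IsAt n (A \ g (k + 1) ρ n) s → C.IsAt n A t →
          ((h n ⌊t.nor⌋₊ : ℕ) : NNReal) ≤ s.nor) :
    IsCCC (CreatingPair.QStar C F) ∧
    VeryExplicitlySourOver cohenName (CreatingPair.QStar.code C F) ∧
    (C.HasAnalyticNorms → IsSouslin (CreatingPair.QStar.code C F)) := by
  have hne : ∀ n, Nonempty (H n) := fun n => inferInstance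
  have ha' : ∃ f ∈ F, ∀ n, ((f n : ℕ) : ℝ≥0) ≤ C.setNorm n (univ : Set (H n)) := by
    obtain ⟨f, hf, hfn⟩ := ha
    refine ⟨f, hf, fun n => ?_⟩
    obtain ⟨t, ht, -⟩ := hcomp.2.2.1 n univ univ_nonempty
    rw [CreatingPair.setNorm_eq hcomp ht]
    exact hfn n t ht
  have hc' : CreatingPair.QStar.RemovalBound C h g ℓ := by
    intro k n A ρ h1 h2 hA
    obtain ⟨s, hs, -⟩ := hcomp.2.2.1 n _ hA
    obtain ⟨t, ht, -⟩ := hcomp.2.2.1 n A (hA.mono sdiff_subset)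
    rw [CreatingPair.setNorm_eq hcomp hs, CreatingPair.setNorm_eq hcomp ht]
    exact hc k n A ρ h1 h2 hA s t hs ht
  exact ⟨CreatingPair.QStar.isCCC hF hFc hFh hFd hcomp hlink,
    CreatingPair.QStar.veryExplicitlySourOver hh hF hFc hFh hFd hcomp hlink hb hc' ha' hne,
    CreatingPair.QStar.isSouslin hF hFc hFh hFd hcomp hlink⟩
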